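/- Let $N=(N_t)_{t\ge 0}$ be a Poisson process with intensity $\lambda>0$, let $(Z_i)_{i\ge1}$ be an i.i.d. sequence of nonnegative-integer-valued random variables, independent of $N$, with $\mathsf P\{Z_1\ge 1\}>0$, and let $S_t=\sum_{i=1}^{N_t}Z_i$, $t\ge0$. Let $q\in(0,1)$, $\mu>0$, $\mu_q=(-\log q)\mu$, and $$I_q=\int_0^\infty q^{S_t+\mu t}\,\mathrm dt ,$$ which is almost surely finite. Define functions $h_{q,j}$, $j=0,1,2,\dots$, by $$h_{q,0}(x)=(1-\mu_q x)^{\lambda \mathsf P\{Z_1\ge1\}/\mu_q-1},\qquad x\le \frac1{\mu_q}$$ (if the exponent is negative, the value at the single point $x=1/\mu_q$ is immaterial and is set to $0$), and, for $j\ge1$ and $x\le q^j/\mu_q$, $$h_{q,j}(x)=h_{q,0}(x)\Bigg((1-q^j)^{1-\lambda \mathsf P\{Z_1\ge1\}/\mu_q}\,h_{q,j-1}\Big(\frac{q^j}{\mu_q}\Big)-\lambda\sum_{k=1}^{j}q^{-k}\,\mathsf P\{Z_1=k\}\int_x^{q^j/\mu_q}(1-\mu_q y)^{-\lambda \mathsf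 P\{Z_1\ge1\}/\mu_q}\,h_{q,j-k}(q^{-k}y)\,\mathrm dy\Bigg).$$ Then all the integrals in this recurrence converge absolutely, each $h_{q,j}$ is integrable on $(q^{j+1}/\mu_q,\,q^j/\mu_q)$, the series $$C=\sum_{j=0}^\infty\int_{q^{j+1}/\mu_q}^{q^j/\mu_q}h_{q,j}(x)\,\mathrm dx$$ converges, $0<C<\infty$, and the distribution of $I_q$ is absolutely continuous with the nonnegative measurable density $$\phi_q(x)=\frac1C\sum_{j=0}^\infty\begin{cases}h_{q,j}(x),&\text{if } \dfrac{q^{j+1}}{\mu_q}<x\le\dfrac{q^j}{\mu_q},\\[1ex]0,&\text{else,}\end{cases}$$ which is $h_{q,j}(x)/C$ on each interval $(q^{j+1}/\mu_q,\,q^j/\mu_q]$ and vanishes outside $(0,1/\mu_q]$. -/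

import Mathlib

open MeasureTheory ProbabilityTheory
open scoped NNReal ENNReal

/-- `N` is a (time-homogeneous) Poisson process with intensity `lam` on `(Ω, P)`: almost surely it
starts from `0` and has nondecreasing right-continuous paths, its increments are independent, and
`N t - N s` is Poisson distributed with parameter `lam * (t - s)` for `s ≤ t`.
(Differences are truncated, but agree a.s. with the true ones since the paths are monotone.) -/
structure IsPoissonProcess {Ω : Type*} [MeasurableSpace Ω] (P : Measure Ω) (lam : ℝ≥0)
    (N : ℝ≥0 → Ω → ℕ) : Prop where
  measurable : ∀ t, Measurable (N t)
  zero : ∀ᵐ ω ∂P, N 0 ω = 0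
  mono : ∀ᵐ ω ∂P, Monotone fun t => N t ω
  rightCts : ∀ᵐ ω ∂P, ∀ t, ContinuousWithinAt (fun s => N s ω) (Set.Ici t) t
  indepIncrements : HasIndepIncrements N P
  law : ∀ s t, s ≤ t → HasLaw (fun ω => N t ω - N s ω) (poissonMeasure (lam * (t - s))) P

/-- The data of a compound Poisson process: `N` is a Poisson process of intensity `lam`, the jumps
`Z 0, Z 1, …` are i.i.d. with values in `ℕ`, and the sequence of jumps is independent of `N`.
(The jumps, numbered from `1` in the usual notation, are numbered from `0` here.) -/
structure IsCompoundPoissonData {Ω : Type*} [MeasurableSpace Ω] (P : Measure Ω) (lam : ℝ≥0)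
    (N : ℝ≥0 → Ω → ℕ) (Z : ℕ → Ω → ℕ) : Prop where
  poisson : IsPoissonProcess P lam N
  measurable : ∀ i, Measurable (Z i)
  iIndep : iIndepFun Z P
  identDistrib : ∀ i, IdentDistrib (Z i) (Z 0) P P
  indep : IndepFun (fun ω t => N t ω) (fun ω i => Z i ω) P

/-- `S_t`, the sum of the first `N_t` jumps. -/
def compoundPoisson {Ω : Type*} (N : ℝ≥0 → Ω → ℕ) (Z : ℕ → Ω → ℕ) (t : ℝ≥0) (ω : Ω) : ℕ :=
  ∑ i ∈ Finset.range (N t ω), Z i ω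

/-- The integrand `t ↦ q ^ (S_t + μ t)`, for real times (only `t ≥ 0` matters). -/
noncomputable def expIntegrand {Ω : Type*} (q mu : ℝ) (S : ℝ≥0 → Ω → ℕ) (ω : Ω) (t : ℝ) : ℝ :=
  q ^ ((S t.toNNReal ω : ℝ) + mu * t)

/-- The exponential functional `I_q = ∫_0^∞ q ^ (S_t + μ t) dt`. -/
noncomputable def expFunctional {Ω : Type*} (q mu : ℝ) (S : ℝ≥0 → Ω → ℕ) (ω : Ω) : ℝ :=
  ∫ t in Set.Ioi (0 : ℝ), expIntegrand q mu S ω t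

/-- `μ_q = (-log q) μ`. -/
noncomputable def driftQ (q mu : ℝ) : ℝ := -Real.log q * mu

/-- The breakpoints `q ^ j / μ_q`. -/
noncomputable def breakpoint (q mu : ℝ) (j : ℕ) : ℝ := q ^ j / driftQ q mu

/-- The basis functions `h_{q,j}`, given by the integral recurrence; `p k` stands for `P{Z₁ = k}`
and `r` for `P{Z₁ ≥ 1}`. The summation index `k = 0, …, j` stands for `k + 1 = 1, …, j + 1`. -/
noncomputable def basisFn (q mu lam r : ℝ) (p : ℕ → ℝ) : ℕ → ℝ → ℝ
  | 0 => fun x => (1 - driftQ q mu * x) ^ (lam * r / driftQ q mu - 1)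
  | j + 1 => fun x =>
      (1 - driftQ q mu * x) ^ (lam * r / driftQ q mu - 1) *
        ((1 - q ^ (j + 1)) ^ (1 - lam * r / driftQ q mu) *
            basisFn q mu lam r p j (breakpoint q mu (j + 1)) -
          lam * ∑ k ∈ Finset.range (j + 1), (q ^ (k + 1))⁻¹ * p (k + 1) *
            ∫ y in x..breakpoint q mu (j + 1),
              (1 - driftQ q mu * y) ^ (-(lam * r / driftQ q mu)) *
                basisFn q mu lam r p (j - k) ((q ^ (k + 1))⁻¹ * y))

/-- The recurrence in its usual indexing. -/
theorem basisFn_recurrence (q mu lam r : ℝ) (p : ℕ → ℝ) (j : ℕ) (hj : 1 ≤ j) (x : ℝ) :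
    basisFn q mu lam r p j x =
      basisFn q mu lam r p 0 x *
        ((1 - q ^ j) ^ (1 - lam * r / driftQ q mu) *
            basisFn q mu lam r p (j - 1) (breakpoint q mu j) -
          lam * ∑ k ∈ Finset.Icc 1 j, (q ^ k)⁻¹ * p k *
            ∫ y in x..breakpoint q mu j,
              (1 - driftQ q mu * y) ^ (-(lam * r / driftQ q mu)) *
                basisFn q mu lam r p (j - k) ((q ^ k)⁻¹ * y)) := by
  obtain ⟨j, rfl⟩ := Nat.exists_eq_add_of_le' hj
  have h : Finset.Icc 1 (j + 1) = (Finset.range (j + 1)).image (· + 1) := by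
    ext k
    simp only [Finset.mem_Icc, Finset.mem_image, Finset.mem_range]
    exact ⟨fun hk => ⟨k - 1, by omega, by omega⟩, fun ⟨i, hi, hk⟩ => by omega⟩
  rw [h, Finset.sum_image (fun a _ b _ hab => Nat.succ_injective hab)]
  simp [basisFn]

/-- The `j`-th summand `∫ h_{q,j}` over `(q^(j+1)/μ_q, q^j/μ_q]` of the normalising constant. -/
noncomputable def basisMass (q mu lam r : ℝ) (p : ℕ → ℝ) (j : ℕ) : ℝ :=
  ∫ x in breakpoint q mu (j + 1)..breakpoint q mu j, basisFn q mu lam r p j x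

/-- The normalising constant `C`. -/
noncomputable def normConst (q mu lam r : ℝ) (p : ℕ → ℝ) : ℝ :=
  ∑' j, basisMass q mu lam r p j

open Classical in
/-- The function `φ_q`, equal to `h_{q,j} / C` on `(q^(j+1)/μ_q, q^j/μ_q]` and `0` elsewhere. -/
noncomputable def densityFn (q mu lam r : ℝ) (p : ℕ → ℝ) (x : ℝ) : ℝ :=
  1 / normConst q mu lam r p *
    ∑' j : ℕ, if breakpoint q mu (j + 1) < x ∧ x ≤ breakpoint q mu j
      then basisFn q mu lam r p j x else 0

/-! Write c = μ_q, X_s = q^(S_s + μ s) and J_t = ∫_t^∞ X_s ds, so that I_q = J_0, and let Φ(n) = n c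
+ λ (1 - E q^(n Z₁)).

Moments. Along each path J^(n+1) has right derivative -(n+1) X J^n, while the increments of S after
time t are independent of the past. Induction on n gives E[Y J_t^n] = (∏_{k ≤ n} k / Φ(k)) E[Y
X_t^n] for bounded Y determined by the past of t (`IsPast.integral_mul_expTail_pow`). With Y = 1 and
t = 0 the moments m_n of I_q satisfy Φ(n+1) m_{n+1} = (n+1) m_n.

Density. The law ν of I_q lives on [0, 1/c], where moments determine a measure. By the layer cake
formula the recursion says that (1 - c x) ν(dx) and λ (P(I > x) - P(q^Z I > x)) dx, with Z an
independent copy of a jump, have the same moments, hence coincide (`HasExpMoments.withDensity_eq`).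
The weight vanishes only at 1/c. An atom there would make c^n m_n drop by at least a constant times
1/(n+1) at each step, against the divergence of the harmonic series. So ν has a density φ.

Identification. Put G(x) = P(I > x), so G' = -φ on (0, 1/c). For q^(j+1)/c ≤ x < 1/c the density
equation reads (1 - c x) φ(x) = λ (r G(x) - ∑_{k ≤ j} p_k G(q^(-k) x)), the remaining arguments
being at least 1/c. Multiplying by (1 - c x)^(-a) with a = λ r / c and differentiating eliminates
φ(x) and leaves exactly the recurrence of the basis functions. Hence φ = K h_{q,j} on the j-th
interval, with one K for all j (`exists_eq_const_mul_basisFn`). Since φ has integral 1, K = 1/C.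
Convergence and positivity of C are thus inherited from φ and need no estimate of the h_{q,j}. -/

/-! ### Generating functions of random blocks of i.i.d. jumps -/

section Jumps

/-- `F` is a function of the first `m` terms of a sequence only. -/
def DependsOnFirst {β : Type*} (F : (ℕ → ℕ) → β) (m : ℕ) : Prop :=
  ∀ z z' : ℕ → ℕ, (∀ i < m, z i = z' i) → F z = F z'

/-- Extension of a finite sequence by zeros. -/
def extendZero (m : ℕ) (v : Finset.range m → ℕ) : ℕ → ℕ :=
  fun i => if h : i ∈ Finset.range m then v ⟨i, h⟩ else 0

theorem measurable_extendZero (m : ℕ) : Measurable (extendZero m) := by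
  refine measurable_pi_lambda _ fun i => ?_
  by_cases h : i ∈ Finset.range m
  · simpa only [extendZero, h, dif_pos] using measurable_pi_apply _
  · simpa only [extendZero, h, dif_neg, not_false_eq_true] using measurable_const

theorem extendZero_apply {m i : ℕ} (hi : i < m) (z : ℕ → ℕ) :
    extendZero m (fun j => z j) i = z i := by
  simp [extendZero, hi]

variable {Ω : Type*} [MeasurableSpace Ω] {P : Measure Ω}

theorem integrable_of_abs_le_one [IsFiniteMeasure P] {Y : Ω → ℝ} (hY : Measurable Y) (h1 : ∀ ω, |Y ω| ≤ 1) :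
    Integrable Y P :=
  Integrable.of_bound hY.aestronglyMeasurable 1 (Filter.Eventually.of_forall h1)

/-- Distinct blocks of an independent sequence are independent. -/
theorem indepFun_first_of_iIndepFun {Z : ℕ → Ω → ℕ} (hZ : iIndepFun Z P)
    (hm : ∀ i, Measurable (Z i)) {m : ℕ} {F : (ℕ → ℕ) → ℝ} (hF : Measurable F)
    (hdep : DependsOnFirst F m) {β : Type*} [MeasurableSpace β] {φ : ℕ → β} :
    IndepFun (fun ω => F (fun i => Z i ω)) (fun ω => φ (Z m ω)) P := by
  have h := hZ.indepFun_finset (Finset.range m) {m} (by simp) hm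
  have hψ : Measurable fun v : ({m} : Finset ℕ) → ℕ => φ (v ⟨m, by simp⟩) :=
    .of_discrete
  have h2 := h.comp (φ := fun v => F (extendZero m v)) (hF.comp (measurable_extendZero m)) hψ
  have h3 : (fun ω => F (fun i => Z i ω)) =
      (fun v => F (extendZero m v)) ∘ fun ω (i : Finset.range m) => Z i ω := by
    ext ω
    exact hdep _ _ fun i hi => (extendZero_apply hi fun i => Z i ω).symm
  rw [h3]
  exact h2

theorem integral_mul_pow_jump {Z : ℕ → Ω → ℕ} (hZ : iIndepFun Z P)
    (hm : ∀ i, Measurable (Z i)) (hid : ∀ i, IdentDistrib (Z i) (Z 0) P P)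
    {m : ℕ} {F : (ℕ → ℕ) → ℝ} (hF : Measurable F)
    (hdep : DependsOnFirst F m) (x : ℝ) :
    ∫ ω, F (fun i => Z i ω) * x ^ Z m ω ∂P =
      (∫ ω, F (fun i => Z i ω) ∂P) * ∫ ω, x ^ Z 0 ω ∂P := by
  rw [IndepFun.integral_fun_mul_eq_mul_integral
    (indepFun_first_of_iIndepFun hZ hm hF hdep (φ := fun k => x ^ k))
    (hF.comp (measurable_pi_lambda _ hm)).aestronglyMeasurable
    ((Measurable.of_discrete (f := fun k : ℕ => x ^ k)).comp (hm m)).aestronglyMeasurable]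
  congr 1
  exact ((hid m).comp (Measurable.of_discrete (f := fun k : ℕ => x ^ k))).integral_eq

/-- Induction on `d`: `F` times the powers of the earlier jumps depends on the first `m + d` jumps
only, hence is independent of the next one. -/
theorem integral_mul_pow_sum_jumps {Z : ℕ → Ω → ℕ} (hZ : iIndepFun Z P)
    (hm : ∀ i, Measurable (Z i)) (hid : ∀ i, IdentDistrib (Z i) (Z 0) P P)
    {m : ℕ} {F : (ℕ → ℕ) → ℝ} (hF : Measurable F)
    (hdep : DependsOnFirst F m) (x : ℝ) (d : ℕ) :
    ∫ ω, F (fun i => Z i ω) * x ^ (∑ i ∈ Finset.Ico m (m + d), Z i ω) ∂P =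
      (∫ ω, F (fun i => Z i ω) ∂P) * (∫ ω, x ^ Z 0 ω ∂P) ^ d := by
  induction d with
  | zero => simp
  | succ d ih =>
    have hG : Measurable fun z : ℕ → ℕ => F z * x ^ (∑ i ∈ Finset.Ico m (m + d), z i) :=
      hF.mul ((Measurable.of_discrete (f := fun k : ℕ => x ^ k)).comp
        (Finset.measurable_sum _ fun i _ => measurable_pi_apply i))
    have := integral_mul_pow_jump hZ hm hid (m := m + d) hG (by
      intro z z' h
      simp only
      rw [hdep z z' fun i hi => h i (by omega), Finset.sum_congr rfl fun i hi =>
        h i (Finset.mem_Ico.1 hi).2]) x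
    rw [pow_succ, ← mul_assoc, ← ih, ← this]
    congr 1
    ext ω
    rw [← Nat.add_assoc, Finset.sum_Ico_succ_top (by omega), pow_add, mul_assoc]

/-- Generating function of the Poisson distribution. -/
theorem integral_pow_poissonMeasure (r : ℝ≥0) (x : ℝ) :
    ∫ n, x ^ n ∂poissonMeasure r = Real.exp (-(r * (1 - x))) := by
  rw [integral_poissonMeasure]
  have : ∀ n : ℕ, (Real.exp (-r) * r ^ n / n.factorial) • x ^ n =
      Real.exp (-r) * ((r * x) ^ n / n.factorial) := fun n => by
    rw [smul_eq_mul, mul_pow]; ring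
  simp_rw [this]
  rw [tsum_mul_left, (NormedSpace.expSeries_div_hasSum_exp ((r : ℝ) * x)).tsum_eq,
    ← Real.exp_eq_exp_ℝ, ← Real.exp_add]
  congr 1; ring

theorem measurable_sum_range_uncurry : Measurable fun x : ℕ × (ℕ → ℕ) =>
    ∑ i ∈ Finset.range x.1, x.2 i :=
  measurable_from_prod_countable_right fun n =>
    Finset.measurable_sum (Finset.range n) fun i _ => measurable_pi_apply i

/-- Adding an independent number `D` of further jumps multiplies expectations by the generating
function of the jumps at the generating function of `D`. -/
theorem integral_mul_pow_sum_random_jumps {Z : ℕ → Ω → ℕ} (hZ : iIndepFun Z P)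
    (hm : ∀ i, Measurable (Z i)) (hid : ∀ i, IdentDistrib (Z i) (Z 0) P P)
    [IsProbabilityMeasure P] {V : Ω → ℕ → ℕ} {D : Ω → ℕ} (hV : Measurable V) (hD : Measurable D)
    (hVD : IndepFun V D P) (hVDZ : IndepFun (fun ω => (V ω, D ω)) (fun ω i => Z i ω) P)
    {c : (ℕ → ℕ) → ℕ} (hc : Measurable c) {f : (ℕ → ℕ) → (ℕ → ℕ) → ℝ}
    (hf : Measurable (Function.uncurry f)) (hf1 : ∀ v z, |f v z| ≤ 1)
    (hdep : ∀ v, DependsOnFirst (f v) (c v)) {x : ℝ} (hx0 : 0 ≤ x) (hx1 : x ≤ 1) :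
    ∫ ω, f (V ω) (fun i => Z i ω) *
        x ^ (∑ i ∈ Finset.Ico (c (V ω)) (c (V ω) + D ω), Z i ω) ∂P =
      (∫ ω, f (V ω) (fun i => Z i ω) ∂P) * ∫ ω, (∫ ω, x ^ Z 0 ω ∂P) ^ D ω ∂P := by
  have hZm : Measurable fun ω i => Z i ω := measurable_pi_lambda _ hm
  have hlaw := (indepFun_iff_map_prod_eq_prod_map_map (hV.prodMk hD).aemeasurable
    hZm.aemeasurable).1 hVDZ
  have hlaw2 := (indepFun_iff_map_prod_eq_prod_map_map hV.aemeasurable hD.aemeasurable).1 hVD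
  have hlaw3 := (indepFun_iff_map_prod_eq_prod_map_map hV.aemeasurable hZm.aemeasurable).1
    (hVDZ.comp measurable_fst measurable_id)
  set κ := P.map fun ω i => Z i ω with hκ
  set α := P.map V with hα
  set δ := P.map D with hδ
  have : IsProbabilityMeasure κ := Measure.isProbabilityMeasure_map hZm.aemeasurable
  have : IsProbabilityMeasure α := Measure.isProbabilityMeasure_map hV.aemeasurable
  have : IsProbabilityMeasure δ := Measure.isProbabilityMeasure_map hD.aemeasurable
  set g := ∫ ω, x ^ Z 0 ω ∂P with hg
  have hsum : Measurable fun y : ((ℕ → ℕ) × ℕ) × (ℕ → ℕ) =>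
      ∑ i ∈ Finset.Ico (c y.1.1) (c y.1.1 + y.1.2), y.2 i := by
    have h1 : Measurable fun y : (ℕ × ℕ) × (ℕ → ℕ) =>
        ∑ i ∈ Finset.Ico y.1.1 (y.1.1 + y.1.2), y.2 i :=
      measurable_from_prod_countable_right fun n =>
        Finset.measurable_sum (Finset.Ico n.1 (n.1 + n.2)) fun i _ => measurable_pi_apply i
    exact h1.comp ((hc.comp (measurable_fst.comp measurable_fst)).prodMk
      (measurable_snd.comp measurable_fst) |>.prodMk measurable_snd)
  have hF : Measurable fun y : ((ℕ → ℕ) × ℕ) × (ℕ → ℕ) =>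
      f y.1.1 y.2 * x ^ (∑ i ∈ Finset.Ico (c y.1.1) (c y.1.1 + y.1.2), y.2 i) :=
    (hf.comp ((measurable_fst.comp measurable_fst).prodMk measurable_snd)).mul
      ((Measurable.of_discrete (f := fun k : ℕ => x ^ k)).comp hsum)
  have hF1 : ∀ y : ((ℕ → ℕ) × ℕ) × (ℕ → ℕ),
      |f y.1.1 y.2 * x ^ (∑ i ∈ Finset.Ico (c y.1.1) (c y.1.1 + y.1.2), y.2 i)| ≤ 1 := by
    intro y
    rw [abs_mul, abs_of_nonneg (pow_nonneg hx0 _)]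
    exact mul_le_one₀ (hf1 _ _) (pow_nonneg hx0 _) (pow_le_one₀ hx0 hx1)
  -- With `v` and `d` frozen the block has a fixed position and length. Independence turns the joint
  -- law into a product, and Fubini then restores the randomness of `V` and `D`.
  have hinner : ∀ v d, ∫ z, f v z * x ^ (∑ i ∈ Finset.Ico (c v) (c v + d), z i) ∂κ =
      (∫ z, f v z ∂κ) * g ^ d := by
    intro v d
    have hfv : Measurable (f v) := hf.comp measurable_prodMk_left
    have hFv : Measurable fun z : ℕ → ℕ =>
        f v z * x ^ (∑ i ∈ Finset.Ico (c v) (c v + d), z i) :=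
      hF.comp (measurable_prodMk_left (x := (v, d)))
    rw [hκ, integral_map hZm.aemeasurable hFv.aestronglyMeasurable,
      integral_map hZm.aemeasurable hfv.aestronglyMeasurable]
    exact integral_mul_pow_sum_jumps hZ hm hid hfv (hdep v) x d
  have hL : ∫ ω, f (V ω) (fun i => Z i ω) *
      x ^ (∑ i ∈ Finset.Ico (c (V ω)) (c (V ω) + D ω), Z i ω) ∂P =
      ∫ y, f y.1.1 y.2 * x ^ (∑ i ∈ Finset.Ico (c y.1.1) (c y.1.1 + y.1.2), y.2 i)
        ∂((α.prod δ).prod κ) := by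
    rw [← hlaw2, ← hlaw, integral_map ((hV.prodMk hD).prodMk hZm).aemeasurable
      hF.aestronglyMeasurable]
  rw [hL, integral_prod _ (integrable_of_abs_le_one hF hF1)]
  simp_rw [hinner]
  have hgm : Measurable fun n : ℕ => g ^ n := .of_discrete
  rw [integral_prod_mul (fun v => ∫ z, f v z ∂κ) (fun d => g ^ d)]
  congr 1
  · rw [← integral_prod (fun y : (ℕ → ℕ) × (ℕ → ℕ) => f y.1 y.2)
      (integrable_of_abs_le_one hf fun y => hf1 _ _), ← hlaw3,
      integral_map (hV.prodMk hZm).aemeasurable (by exact hf.aestronglyMeasurable)]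
  · rw [hδ, integral_map hD.aemeasurable hgm.aestronglyMeasurable]

end Jumps

/-! ### Variables determined by the past, and independence of later increments -/

section Past

variable {Ω : Type*}

/-- The increments of `N` along the sequence of times `τ`. -/
def countIncrements (N : ℝ≥0 → Ω → ℕ) (τ : ℕ → ℝ≥0) (ω : Ω) (i : ℕ) : ℕ :=
  N (τ (i + 1)) ω - N (τ i) ω

/-- The random variable `Y` is bounded by `1` and a function of finitely many increments of `N` up
to time `t` and of the first `N t` jumps. -/
def IsPast (N : ℝ≥0 → Ω → ℕ) (Z : ℕ → Ω → ℕ) (t : ℝ≥0) (Y : Ω → ℝ) : Prop :=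
  ∃ (τ : ℕ → ℝ≥0) (k : ℕ) (f : (ℕ → ℕ) → (ℕ → ℕ) → ℝ), Monotone τ ∧ τ 0 = 0 ∧ τ k = t ∧
    Measurable (Function.uncurry f) ∧ (∀ v z, |f v z| ≤ 1) ∧
    (∀ v v' z z', (∀ i < k, v i = v' i) → (∀ i < ∑ j ∈ Finset.range k, v j, z i = z' i) →
      f v z = f v' z') ∧
    ∀ ω, Y ω = f (countIncrements N τ ω) fun i => Z i ω

variable {N : ℝ≥0 → Ω → ℕ} {Z : ℕ → Ω → ℕ}

theorem sum_countIncrements (hmono : ∀ ω, Monotone fun t => N t ω) (h0 : ∀ ω, N 0 ω = 0)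
    {τ : ℕ → ℝ≥0} (hτ : Monotone τ) (hτ0 : τ 0 = 0) (k : ℕ) (ω : Ω) :
    ∑ i ∈ Finset.range k, countIncrements N τ ω i = N (τ k) ω := by
  unfold countIncrements
  rw [Finset.sum_range_tsub (f := fun i => N (τ i) ω) ((hmono ω).comp hτ), hτ0, h0, Nat.sub_zero]

theorem isPast_one : IsPast N Z 0 fun _ => 1 :=
  ⟨fun _ => 0, 0, fun _ _ => 1, monotone_const, rfl, rfl, measurable_const, by simp, by simp,
    by simp⟩

/-- Append `s` to the time grid; the number of admissible jumps can only grow. -/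
theorem IsPast.mono {s t : ℝ≥0} {Y : Ω → ℝ} (hY : IsPast N Z t Y) (hts : t ≤ s) :
    IsPast N Z s Y := by
  obtain ⟨τ, k, f, hτ, hτ0, hτk, hf, hf1, hdep, hY⟩ := hY
  refine ⟨fun i => if i ≤ k then τ i else s, k + 1, f, ?_, by simpa using hτ0, by simp, hf, hf1,
    ?_, ?_⟩
  · intro i j hij
    by_cases hj : j ≤ k
    · simpa [hj, hij.trans hj] using hτ hij
    · by_cases hi : i ≤ k
      · simpa [hi, hj] using ((hτ hi).trans hτk.le).trans hts
      · simp [hi, hj]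
  · intro v v' z z' hv hz
    refine hdep v v' z z' (fun i hi => hv i (by omega)) fun i hi => hz i ?_
    rw [Finset.sum_range_succ]
    omega
  · intro ω
    rw [hY]
    refine hdep _ _ _ _ (fun i hi => ?_) fun _ _ => rfl
    simp [countIncrements, hi.le, Nat.succ_le_of_lt hi]

theorem IsPast.abs_le_one {t : ℝ≥0} {Y : Ω → ℝ} (hY : IsPast N Z t Y) (ω : Ω) : |Y ω| ≤ 1 := by
  obtain ⟨τ, k, f, -, -, -, -, hf1, -, hY⟩ := hY
  rw [hY]
  exact hf1 _ _

/-- The first `k` increments add up to `N t`, so `S_t` is a function of the admissible data. This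
closure property is what lets the moment induction feed a factor `q ^ S_s` back into the past
variable. -/
theorem IsPast.mul_pow_compoundPoisson (hmono : ∀ ω, Monotone fun t => N t ω)
    (h0 : ∀ ω, N 0 ω = 0) {t : ℝ≥0} {Y : Ω → ℝ} (hY : IsPast N Z t Y) {x : ℝ} (hx0 : 0 ≤ x)
    (hx1 : x ≤ 1) : IsPast N Z t fun ω => Y ω * x ^ compoundPoisson N Z t ω := by
  obtain ⟨τ, k, f, hτ, hτ0, rfl, hf, hf1, hdep, hY⟩ := hY
  refine ⟨τ, k, fun v z => f v z * x ^ (∑ i ∈ Finset.range (∑ j ∈ Finset.range k, v j), z i), hτ,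
    hτ0, rfl, ?_, ?_, ?_, ?_⟩
  · have hc : Measurable fun v : ℕ → ℕ => ∑ j ∈ Finset.range k, v j :=
      Finset.measurable_sum _ fun _ _ => measurable_pi_apply _
    exact hf.mul ((Measurable.of_discrete (f := fun k : ℕ => x ^ k)).comp
      (measurable_sum_range_uncurry.comp ((hc.comp measurable_fst).prodMk measurable_snd)))
  · intro v z
    rw [abs_mul, abs_of_nonneg (pow_nonneg hx0 _)]
    exact mul_le_one₀ (hf1 _ _) (pow_nonneg hx0 _) (pow_le_one₀ hx0 hx1)
  · intro v v' z z' hv hz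
    have : ∑ j ∈ Finset.range k, v j = ∑ j ∈ Finset.range k, v' j :=
      Finset.sum_congr rfl fun i hi => hv i (Finset.mem_range.1 hi)
    simp only
    rw [hdep v v' z z' hv hz, ← this]
    congr 2
    exact Finset.sum_congr rfl fun i hi => hz i (Finset.mem_range.1 hi)
  · intro ω
    simp only [hY, sum_countIncrements hmono h0 hτ hτ0, compoundPoisson]

variable [MeasurableSpace Ω]

theorem measurable_countIncrements (hN : ∀ t, Measurable (N t)) (τ : ℕ → ℝ≥0) :
    Measurable (countIncrements N τ) :=
  measurable_pi_lambda _ fun _ => (hN _).sub (hN _)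

theorem IsPast.measurable (hN : ∀ t, Measurable (N t)) (hZ : ∀ i, Measurable (Z i)) {t : ℝ≥0}
    {Y : Ω → ℝ} (hY : IsPast N Z t Y) : Measurable Y := by
  obtain ⟨τ, k, f, -, -, -, hf, -, -, hY⟩ := hY
  have : Y = fun ω => Function.uncurry f (countIncrements N τ ω, fun i => Z i ω) := funext hY
  rw [this]
  exact hf.comp ((measurable_countIncrements hN τ).prodMk (measurable_pi_lambda _ hZ))

/-- The jumps after time `t` are independent of the past. -/
theorem IsPast.integral_mul_pow {P : Measure Ω} [IsProbabilityMeasure P] {lam : ℝ≥0}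
    (hNZ : IsCompoundPoissonData P lam N Z) (hmono : ∀ ω, Monotone fun t => N t ω)
    (h0 : ∀ ω, N 0 ω = 0) {s t : ℝ≥0} {Y : Ω → ℝ} (hY : IsPast N Z t Y) (hts : t ≤ s) {x : ℝ}
    (hx0 : 0 ≤ x) (hx1 : x ≤ 1) :
    ∫ ω, Y ω * x ^ compoundPoisson N Z s ω ∂P =
      (∫ ω, Y ω * x ^ compoundPoisson N Z t ω ∂P) *
        Real.exp (-(lam * (s - t) * (1 - ∫ ω, x ^ Z 0 ω ∂P))) := by
  obtain ⟨τ, k, f, hτ, hτ0, hτk, hf, hf1, hdep, hY'⟩ :=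
    hY.mul_pow_compoundPoisson hmono h0 hx0 hx1
  have hNm := hNZ.poisson.measurable
  -- The grid is continued by `s`, so that `N s - N t` becomes its `k`-th increment, independent of
  -- those before it.
  set τ' : ℕ → ℝ≥0 := fun i => if i ≤ k then τ i else s with hτ'
  have hτ'm : Monotone τ' := by
    intro i j hij
    by_cases hj : j ≤ k
    · simpa [hτ', hj, hij.trans hj] using hτ hij
    · by_cases hi : i ≤ k
      · simpa [hτ', hi, hj] using ((hτ hi).trans hτk.le).trans hts
      · simp [hτ', hi, hj]
  have hind := hNZ.poisson.indepIncrements.nat hτ'm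
  have hDm : ∀ i, Measurable fun ω => N (τ' (i + 1)) ω - N (τ' i) ω :=
    fun i => (hNm _).sub (hNm _)
  -- Entries from index `k` on are replaced by zero: the full sequence of increments would contain
  -- `D` itself.
  set V : Ω → ℕ → ℕ := fun ω => extendZero k fun i => countIncrements N τ' ω i with hV
  set D : Ω → ℕ := fun ω => N s ω - N t ω with hD
  have hVm : Measurable V := (measurable_extendZero k).comp
    (measurable_pi_lambda _ fun i => hDm i)
  have hVD : IndepFun V D P := by
    have h := hind.indepFun_finset (Finset.range k) {k} (by simp) hDm
    have hψ : Measurable fun v : ({k} : Finset ℕ) → ℕ => v ⟨k, by simp⟩ := .of_discrete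
    have h2 := h.comp (measurable_extendZero k) hψ
    have h3 : D = (fun v : ({k} : Finset ℕ) → ℕ => v ⟨k, by simp⟩) ∘
        fun ω (i : ({k} : Finset ℕ)) => N (τ' (i + 1)) ω - N (τ' i) ω := by
      ext ω
      simp [hD, hτ', hτk]
    rw [h3]
    exact h2
  have hVDZ : IndepFun (fun ω => (V ω, D ω)) (fun ω i => Z i ω) P := by
    have hφ : Measurable fun n : ℝ≥0 → ℕ => ((extendZero k fun i : Finset.range k =>
        n (τ' (i + 1)) - n (τ' i) : ℕ → ℕ), n s - n t) :=
      ((measurable_extendZero k).comp (measurable_pi_lambda _ fun i =>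
        (measurable_pi_apply (τ' (i + 1))).sub (measurable_pi_apply (τ' i)))).prodMk
        ((measurable_pi_apply s).sub (measurable_pi_apply t))
    exact hNZ.indep.comp hφ measurable_id
  have hVi : ∀ ω, ∀ i < k, countIncrements N τ ω i = V ω i := by
    intro ω i hi
    rw [hV]
    simp only
    rw [extendZero_apply hi]
    simp [countIncrements, hτ', hi.le, Nat.succ_le_of_lt hi]
  have hc : Measurable fun v : ℕ → ℕ => ∑ j ∈ Finset.range k, v j :=
    Finset.measurable_sum _ fun _ _ => measurable_pi_apply _
  have hcV : ∀ ω, ∑ j ∈ Finset.range k, V ω j = N t ω := by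
    intro ω
    rw [← hτk, ← sum_countIncrements hmono h0 hτ hτ0]
    exact Finset.sum_congr rfl fun i hi => (hVi ω i (Finset.mem_range.1 hi)).symm
  have hfV : ∀ ω, f (V ω) (fun i => Z i ω) = Y ω * x ^ compoundPoisson N Z t ω := by
    intro ω
    refine Eq.trans ?_ (hY' ω).symm
    exact (hdep _ _ _ _ (hVi ω) fun _ _ => rfl).symm
  have key := integral_mul_pow_sum_random_jumps hNZ.iIndep hNZ.measurable hNZ.identDistrib hVm
    ((hNm s).sub (hNm t)) hVD hVDZ hc hf hf1
    (fun v z z' h => hdep v v z z' (fun _ _ => rfl) h) hx0 hx1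
  simp only [hcV, hfV, Pi.sub_apply] at key
  have hlaw := (hNZ.poisson.law t s hts).integral_comp
    (f := fun n : ℕ => (∫ ω, x ^ Z 0 ω ∂P) ^ n) AEStronglyMeasurable.of_discrete
  simp only [Function.comp_def, integral_pow_poissonMeasure] at hlaw
  rw [hlaw] at key
  convert key using 1
  · congr 1
    ext ω
    rw [mul_assoc, ← pow_add]
    congr 2
    simp only [compoundPoisson]
    rw [Nat.add_sub_cancel' (hmono ω hts), Finset.sum_range_add_sum_Ico _ (hmono ω hts)]
  · congr 3
    push_cast [hts]
    ring

end Past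

/-! ### Powers of a tail integral -/

section Tail

open Set Filter Topology

theorem setIntegral_Ioi_eq_sub {x : ℝ → ℝ} {t s : ℝ} (hx : IntegrableOn x (Ioi t)) (hts : t ≤ s) :
    ∫ u in Ioi s, x u = (∫ u in Ioi t, x u) - ∫ u in t..s, x u := by
  rw [← intervalIntegral.integral_interval_add_Ioi hx (hx.mono_set (Ioi_subset_Ioi hts))]
  ring

theorem continuousOn_setIntegral_Ioi {x : ℝ → ℝ} {t : ℝ} (hx : IntegrableOn x (Ioi t)) :
    ContinuousOn (fun s => ∫ u in Ioi s, x u) (Ici t) := by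
  intro T hT
  have h : ContinuousOn (fun s => (∫ u in Ioi t, x u) - ∫ u in t..s, x u) (Icc t (T + 1)) :=
    continuousOn_const.sub (by
      have hT' : t ≤ T + 1 := by linarith [mem_Ici.1 hT]
      rw [← uIcc_of_le hT']
      refine intervalIntegral.continuousOn_primitive_interval ?_
      rw [uIcc_of_le hT', integrableOn_Icc_iff_integrableOn_Ioc]
      exact hx.mono_set Ioc_subset_Ioi_self)
  have h2 : ContinuousWithinAt (fun s => ∫ u in Ioi s, x u) (Icc t (T + 1)) T :=
    (h T ⟨hT, by linarith⟩).congr (fun s hs => setIntegral_Ioi_eq_sub hx hs.1)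
      (setIntegral_Ioi_eq_sub hx hT)
  refine h2.mono_of_mem_nhdsWithin ?_
  rw [← Ici_inter_Iic]
  exact inter_mem_nhdsWithin _ (Iic_mem_nhds (by linarith))

/-- Powers of the tail integral of a right-continuous function. -/
theorem tailIntegral_pow_succ {x : ℝ → ℝ} {t : ℝ} (hx : IntegrableOn x (Ioi t))
    (hx0 : ∀ s, 0 ≤ x s) (hrc : ∀ s, ContinuousWithinAt x (Ici s) s) (n : ℕ) :
    (∫ u in Ioi t, x u) ^ (n + 1) =
      (n + 1) * ∫ s in Ioi t, x s * (∫ u in Ioi s, x u) ^ n := by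
  set J : ℝ → ℝ := fun s => ∫ u in Ioi s, x u with hJ
  have hJ0 : ∀ s, 0 ≤ J s := fun s => integral_nonneg fun u => hx0 u
  have hJt : ∀ s ∈ Ioi t, J s ≤ J t := fun s hs =>
    setIntegral_mono_set hx (Eventually.of_forall hx0) (Ioi_subset_Ioi (le_of_lt hs)).eventuallyLE
  have hJc := continuousOn_setIntegral_Ioi hx
  have hint : IntegrableOn (fun s => x s * J s ^ n) (Ioi t) := by
    refine Integrable.mul_bdd (c := J t ^ n) hx ?_ ?_
    · exact ((hJc.mono Ioi_subset_Ici_self).pow n).aestronglyMeasurable measurableSet_Ioi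
    · filter_upwards [ae_restrict_mem measurableSet_Ioi] with s hs
      rw [Real.norm_of_nonneg (pow_nonneg (hJ0 s) n)]
      exact pow_le_pow_left₀ (hJ0 s) (hJt s hs) n
  -- Since `x` may jump, only a right derivative exists. Together with continuity of `J` this is
  -- enough for the fundamental theorem of calculus.
  have hder : ∀ s, t < s → HasDerivWithinAt J (-x s) (Ioi s) s := by
    intro s hs
    have h1 : HasDerivWithinAt (fun s' => (∫ u in Ioi t, x u) - ∫ u in t..s', x u) (-x s)
        (Ioi s) s := by
      have := intervalIntegral.integral_hasDerivWithinAt_right (f := x) (a := t) (b := s)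
        (s := Ici s) (t := Ioi s) ?_ ?_ ((hrc s).mono Ioi_subset_Ici_self)
      · simpa using ((this.mono Ioi_subset_Ici_self).const_sub (∫ u in Ioi t, x u))
      · rw [intervalIntegrable_iff_integrableOn_Ioc_of_le hs.le]
        exact hx.mono_set Ioc_subset_Ioi_self
      · exact ⟨Ioi s, self_mem_nhdsWithin,
          (hx.mono_set (Ioi_subset_Ioi hs.le)).aestronglyMeasurable⟩
    exact h1.congr (fun s' hs' => setIntegral_Ioi_eq_sub hx (hs.le.trans (le_of_lt hs')))
      (setIntegral_Ioi_eq_sub hx hs.le)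
  have hftc : ∀ T, t ≤ T → ∫ s in t..T, (n + 1) * (x s * J s ^ n) =
      J t ^ (n + 1) - J T ^ (n + 1) := by
    intro T hT
    have := intervalIntegral.integral_eq_sub_of_hasDeriv_right_of_le (a := t) (b := T)
      (f := fun s => - J s ^ (n + 1)) (f' := fun s => (n + 1) * (x s * J s ^ n)) hT
      (((hJc.mono Icc_subset_Ici_self).pow _).neg) ?_ ?_
    · rw [this]; ring
    · intro s hs
      convert! ((hder s hs.1).pow (n + 1)).neg using 1
      push_cast
      simp
      ring
    · rw [intervalIntegrable_iff_integrableOn_Ioc_of_le hT]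
      exact (hint.mono_set Ioc_subset_Ioi_self).const_mul _
  have hlimJ : Tendsto J atTop (𝓝 0) := by
    have h := (intervalIntegral_tendsto_integral_Ioi t hx tendsto_id).const_sub (J t)
    simp only [hJ, sub_self] at h
    refine h.congr' ?_
    filter_upwards [eventually_ge_atTop t] with s hs
    exact (setIntegral_Ioi_eq_sub hx hs).symm
  have hlim1 := intervalIntegral_tendsto_integral_Ioi t (hint.const_mul ((n : ℝ) + 1)) tendsto_id
  have hlim2 : Tendsto (fun T => J t ^ (n + 1) - J T ^ (n + 1)) atTop
      (𝓝 (J t ^ (n + 1) - 0 ^ (n + 1))) := (hlimJ.pow _).const_sub _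
  have := tendsto_nhds_unique hlim1 (hlim2.congr' (by
    filter_upwards [eventually_ge_atTop t] with T hT
    exact (hftc T hT).symm))
  rw [← integral_const_mul]
  rw [this]
  simp [hJ]



end Tail

/-! ### Joint moments of the tail integral and the past -/

section Moments

open Set Filter Topology

/-- Every path of `N` is nondecreasing and right-continuous, and starts from `0`. -/
structure HasRegularPaths {Ω : Type*} (N : ℝ≥0 → Ω → ℕ) : Prop where
  zero : ∀ ω, N 0 ω = 0
  mono : ∀ ω, Monotone fun t => N t ω
  rightCts : ∀ ω t, ContinuousWithinAt (fun s => N s ω) (Ici t) t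

theorem driftQ_pos {q mu : ℝ} (hq0 : 0 < q) (hq1 : q < 1) (hmu : 0 < mu) : 0 < driftQ q mu :=
  mul_pos (neg_pos.2 (Real.log_neg hq0 hq1)) hmu

variable {Ω : Type*} {N : ℝ≥0 → Ω → ℕ} {Z : ℕ → Ω → ℕ} {q mu : ℝ}

theorem expIntegrand_eq (hq0 : 0 < q) (S : ℝ≥0 → Ω → ℕ) (ω : Ω) (t : ℝ) :
    expIntegrand q mu S ω t = q ^ S t.toNNReal ω * Real.exp (-(driftQ q mu * t)) := by
  rw [expIntegrand, Real.rpow_add hq0, Real.rpow_natCast, Real.rpow_def_of_pos hq0, driftQ]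
  ring_nf

theorem expIntegrand_pos (hq0 : 0 < q) (S : ℝ≥0 → Ω → ℕ) (ω : Ω) (t : ℝ) :
    0 < expIntegrand q mu S ω t :=
  Real.rpow_pos_of_pos hq0 _

theorem expIntegrand_le (hq0 : 0 < q) (hq1 : q < 1) (S : ℝ≥0 → Ω → ℕ) (ω : Ω) (t : ℝ) :
    expIntegrand q mu S ω t ≤ Real.exp (-(driftQ q mu * t)) := by
  rw [expIntegrand_eq hq0]
  exact mul_le_of_le_one_left (Real.exp_pos _).le (pow_le_one₀ hq0.le hq1.le)

theorem continuousWithinAt_expIntegrand (hN : HasRegularPaths N) (hq0 : 0 < q) (ω : Ω) (t : ℝ) :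
    ContinuousWithinAt (expIntegrand q mu (compoundPoisson N Z) ω) (Ici t) t := by
  have h1 : ContinuousWithinAt (fun s : ℝ => N s.toNNReal ω) (Ici t) t :=
    (hN.rightCts ω t.toNNReal).comp (f := Real.toNNReal) continuous_real_toNNReal.continuousWithinAt
      fun s hs => Real.toNNReal_le_toNNReal hs
  have h2 : ContinuousWithinAt (fun s : ℝ => q ^ compoundPoisson N Z s.toNNReal ω) (Ici t) t :=
    (continuous_of_discreteTopology (f := fun n : ℕ =>
      q ^ (∑ i ∈ Finset.range n, Z i ω))).continuousAt.comp_continuousWithinAt h1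
  have h3 : ContinuousWithinAt (fun s : ℝ => Real.exp (-(driftQ q mu * s))) (Ici t) t := by
    fun_prop
  exact (h2.mul h3).congr (fun s _ => expIntegrand_eq hq0 _ ω s) (expIntegrand_eq hq0 _ ω t)

/-- The remainder `∫_t^∞ q ^ (S_s + μ s) ds` of the exponential functional. -/
noncomputable def expTail (q mu : ℝ) (S : ℝ≥0 → Ω → ℕ) (ω : Ω) (t : ℝ) : ℝ :=
  ∫ s in Ioi t, expIntegrand q mu S ω s

theorem expTail_nonneg (hq0 : 0 < q) (S : ℝ≥0 → Ω → ℕ) (ω : Ω) (t : ℝ) :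
    0 ≤ expTail q mu S ω t :=
  integral_nonneg fun s => (expIntegrand_pos hq0 S ω s).le

variable [MeasurableSpace Ω]

/-- A right-continuous process is jointly measurable. -/
theorem measurable_uncurry_of_rightCts (hN : HasRegularPaths N) (hm : ∀ t, Measurable (N t)) :
    Measurable fun x : Ω × ℝ => N x.2.toNNReal x.1 := by
  -- Times are rounded up to the grid of mesh 1/(n+1). Each discretised process takes countably many
  -- times, hence is jointly measurable, and approaching from the right makes right continuity
  -- sufficient.
  obtain ⟨e, he⟩ : ∃ e : ℕ → ℕ → ℝ≥0, ∀ n k, e n k = (k + 1) / (n + 1) := ⟨_, fun _ _ => rfl⟩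
  set d : ℕ → ℝ≥0 → ℝ≥0 := fun n t => e n ⌊t * (n + 1)⌋₊ with hd
  have hd_gt : ∀ n t, t ≤ d n t := fun n t => by
    simp only [hd, he]
    rw [le_div_iff₀ (by positivity)]
    exact (Nat.lt_floor_add_one _).le
  have hd_le : ∀ n t, d n t ≤ t + 1 / (n + 1) := fun n t => by
    simp only [hd, he]
    rw [div_le_iff₀ (by positivity), add_mul, div_mul_cancel₀ _ (by positivity)]
    gcongr
    exact Nat.floor_le (by positivity)
  have hlim : ∀ t, Tendsto (fun n => d n t) atTop (𝓝[≥] t) := by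
    intro t
    refine tendsto_nhdsWithin_iff.2 ⟨?_, Eventually.of_forall fun n => hd_gt n t⟩
    refine tendsto_of_tendsto_of_tendsto_of_le_of_le tendsto_const_nhds ?_ (fun n => hd_gt n t)
      (fun n => hd_le n t)
    simpa using tendsto_const_nhds.add (tendsto_one_div_add_atTop_nhds_zero_nat (𝕜 := ℝ≥0))
  refine measurable_of_tendsto_metrizable (f := fun n (x : Ω × ℝ) => N (d n x.2.toNNReal) x.1)
    (fun n => ?_) ?_
  · have h1 : Measurable fun y : Ω × ℕ => N (e n y.2) y.1 :=
      measurable_from_prod_countable_left fun k => hm (e n k)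
    have h2 : Measurable fun x : Ω × ℝ => (x.1, ⌊x.2.toNNReal * ((n : ℝ≥0) + 1)⌋₊) :=
      measurable_fst.prodMk (Nat.measurable_floor.comp
        ((measurable_real_toNNReal.comp measurable_snd).mul_const _))
    exact h1.comp h2
  · rw [tendsto_pi_nhds]
    intro x
    exact (hN.rightCts x.1 x.2.toNNReal).tendsto.comp (hlim x.2.toNNReal)

theorem measurable_expIntegrand_uncurry (hN : HasRegularPaths N) (hm : ∀ t, Measurable (N t))
    (hZ : ∀ i, Measurable (Z i)) :
    Measurable fun x : Ω × ℝ => expIntegrand q mu (compoundPoisson N Z) x.1 x.2 := by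
  have h1 : Measurable fun x : Ω × ℝ => compoundPoisson N Z x.2.toNNReal x.1 :=
    measurable_sum_range_uncurry.comp ((measurable_uncurry_of_rightCts hN hm).prodMk
      ((measurable_pi_lambda _ hZ).comp measurable_fst))
  unfold expIntegrand
  have h2 : Measurable fun x : Ω × ℝ => ((compoundPoisson N Z x.2.toNNReal x.1 : ℕ) : ℝ) :=
    (Measurable.of_discrete (f := fun n : ℕ => (n : ℝ))).comp h1
  fun_prop

theorem integrableOn_expIntegrand (hN : HasRegularPaths N) (hm : ∀ t, Measurable (N t))
    (hZ : ∀ i, Measurable (Z i)) (hq0 : 0 < q) (hq1 : q < 1) (hmu : 0 < mu) (ω : Ω) (t : ℝ) :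
    IntegrableOn (expIntegrand q mu (compoundPoisson N Z) ω) (Ioi t) := by
  refine Integrable.mono' (g := fun s => Real.exp (-(driftQ q mu * s))) ?_
    ((measurable_expIntegrand_uncurry hN hm hZ).comp
      (measurable_prodMk_left (x := ω))).aestronglyMeasurable
    (Eventually.of_forall fun s => ?_)
  · simp only [← neg_mul]
    exact exp_neg_integrableOn_Ioi t (driftQ_pos hq0 hq1 hmu)
  · rw [Real.norm_of_nonneg (expIntegrand_pos hq0 _ ω s).le]
    exact expIntegrand_le hq0 hq1 _ ω s

theorem expTail_le (hN : HasRegularPaths N) (hm : ∀ t, Measurable (N t))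
    (hZ : ∀ i, Measurable (Z i)) (hq0 : 0 < q) (hq1 : q < 1) (hmu : 0 < mu) (ω : Ω) {t : ℝ}
    (ht : 0 ≤ t) : expTail q mu (compoundPoisson N Z) ω t ≤ 1 / driftQ q mu := by
  have hc := driftQ_pos hq0 hq1 hmu
  have h1 : IntegrableOn (fun s => Real.exp (-driftQ q mu * s)) (Ioi t) :=
    exp_neg_integrableOn_Ioi t hc
  have h2 : ∫ s in Ioi t, Real.exp (-driftQ q mu * s) =
      Real.exp (-driftQ q mu * t) / driftQ q mu := by
    rw [integral_exp_mul_Ioi (by linarith) t]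
    ring
  calc expTail q mu (compoundPoisson N Z) ω t
      ≤ ∫ s in Ioi t, Real.exp (-driftQ q mu * s) := by
        refine integral_mono (integrableOn_expIntegrand hN hm hZ hq0 hq1 hmu ω t) h1 fun s => ?_
        simpa only [← neg_mul] using expIntegrand_le (mu := mu) hq0 hq1 (compoundPoisson N Z) ω s
    _ ≤ 1 / driftQ q mu := by
        rw [h2]
        gcongr
        rw [Real.exp_le_one_iff]
        nlinarith

theorem measurable_expTail_uncurry (hN : HasRegularPaths N) (hm : ∀ t, Measurable (N t))
    (hZ : ∀ i, Measurable (Z i)) :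
    Measurable fun x : Ω × ℝ => expTail q mu (compoundPoisson N Z) x.1 x.2 := by
  have h : Measurable fun y : (Ω × ℝ) × ℝ =>
      (Ioi y.1.2).indicator (expIntegrand q mu (compoundPoisson N Z) y.1.1) y.2 := by
    have h1 : MeasurableSet {y : (Ω × ℝ) × ℝ | y.1.2 < y.2} :=
      measurableSet_lt (measurable_snd.comp measurable_fst) measurable_snd
    exact ((measurable_expIntegrand_uncurry hN hm hZ).comp
      ((measurable_fst.comp measurable_fst).prodMk measurable_snd)).indicator h1
  have h2 := h.stronglyMeasurable.integral_prod_right' (ν := (volume : Measure ℝ))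
  simp only [integral_indicator measurableSet_Ioi] at h2
  exact h2.measurable

variable {P : Measure Ω} [IsProbabilityMeasure P] {lam : ℝ≥0}

/-- The exponent `Φ` with `E q ^ (n (S_t + μ t)) = exp (- t Φ n)`; here `g n = E q ^ (n Z₁)`. -/
noncomputable def laplaceExp (c lam : ℝ) (g : ℕ → ℝ) (n : ℕ) : ℝ := n * c + lam * (1 - g n)

/-- The generating function of the jumps at `q ^ n`. -/
noncomputable def jumpGen (P : Measure Ω) (Z : ℕ → Ω → ℕ) (q : ℝ) (n : ℕ) : ℝ :=
  ∫ ω, (q ^ n) ^ Z 0 ω ∂P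

/-- The independence of later jumps at `x = q ^ n`, with the deterministic drift absorbed into the
exponent: exp(s Φ(n)) X_s^n is a martingale. -/
theorem IsPast.integral_mul_expIntegrand_pow (hNZ : IsCompoundPoissonData P lam N Z)
    (hN : HasRegularPaths N) (hq0 : 0 < q) (hq1 : q < 1) {t : ℝ≥0} {Y : Ω → ℝ}
    (hY : IsPast N Z t Y) {s : ℝ} (hts : (t : ℝ) ≤ s) (n : ℕ) :
    ∫ ω, Y ω * expIntegrand q mu (compoundPoisson N Z) ω s ^ n ∂P =
      (∫ ω, Y ω * expIntegrand q mu (compoundPoisson N Z) ω t ^ n ∂P) *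
        Real.exp (-(laplaceExp (driftQ q mu) lam (jumpGen P Z q) n * (s - t))) := by
  lift s to ℝ≥0 using t.2.trans hts
  have key := hY.integral_mul_pow hNZ hN.mono hN.zero (NNReal.coe_le_coe.1 hts)
    (pow_nonneg hq0.le n) (pow_le_one₀ hq0.le hq1.le)
  have h1 : ∀ u : ℝ≥0, ∫ ω, Y ω * expIntegrand q mu (compoundPoisson N Z) ω u ^ n ∂P =
      (∫ ω, Y ω * (q ^ n) ^ compoundPoisson N Z u ω ∂P) *
        Real.exp (-(driftQ q mu * u)) ^ n := by
    intro u
    rw [← integral_mul_const]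
    congr 1
    ext ω
    rw [expIntegrand_eq hq0, Real.toNNReal_coe, mul_pow, ← pow_mul, ← pow_mul, mul_comm n,
      mul_assoc]
  have h2 : ∀ A a b c d : ℝ, a * b = c * d → A * a * b = A * c * d := fun A a b c d h => by
    rw [mul_assoc, h, mul_assoc]
  rw [h1, h1, key]
  refine h2 _ _ _ _ _ ?_
  rw [← Real.exp_nat_mul, ← Real.exp_nat_mul, ← Real.exp_add, ← Real.exp_add, laplaceExp, jumpGen]
  congr 1
  ring

/-- Expand J_t^(n+1) as (n+1) ∫_t^∞ X_s J_s^n ds, exchange integrals, and use the case `n` at each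
later time s. What remains is E[Y X_s^(n+1)] = E[Y X_t^(n+1)] exp(-Φ(n+1)(s - t)), whose time
integral contributes 1/Φ(n+1). The time and the past variable are quantified inside the induction
because both change. -/
theorem IsPast.integral_mul_expTail_pow (hNZ : IsCompoundPoissonData P lam N Z)
    (hN : HasRegularPaths N) (hq0 : 0 < q) (hq1 : q < 1) (hmu : 0 < mu)
    (hΦ : ∀ n, 0 < laplaceExp (driftQ q mu) lam (jumpGen P Z q) (n + 1)) (n : ℕ) :
    ∀ {t : ℝ≥0} {Y : Ω → ℝ}, IsPast N Z t Y →
    ∫ ω, Y ω * expTail q mu (compoundPoisson N Z) ω t ^ n ∂P =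
      (∏ k ∈ Finset.range n, ((k : ℝ) + 1) /
        laplaceExp (driftQ q mu) lam (jumpGen P Z q) (k + 1)) *
      ∫ ω, Y ω * expIntegrand q mu (compoundPoisson N Z) ω t ^ n ∂P := by
  have hm := hNZ.poisson.measurable
  have hZ := hNZ.measurable
  have hc := driftQ_pos hq0 hq1 hmu
  induction n with
  | zero => simp
  | succ n ih =>
    intro t Y hY
    set X : Ω → ℝ → ℝ := expIntegrand q mu (compoundPoisson N Z) with hX
    set J : Ω → ℝ → ℝ := expTail q mu (compoundPoisson N Z) with hJ
    set M : ℝ := ∏ k ∈ Finset.range n, ((k : ℝ) + 1) /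
        laplaceExp (driftQ q mu) lam (jumpGen P Z q) (k + 1)
    set Φ := laplaceExp (driftQ q mu) lam (jumpGen P Z q) (n + 1) with hΦdef
    have hstep : ∀ s : ℝ, (t : ℝ) < s → ∫ ω, Y ω * (X ω s * J ω s ^ n) ∂P =
        M * (∫ ω, Y ω * X ω t ^ (n + 1) ∂P) * Real.exp (-(Φ * (s - t))) := by
      intro s hs
      lift s to ℝ≥0 using t.2.trans hs.le
      have hts : t ≤ s := (NNReal.coe_lt_coe.1 hs).le
      -- The random part `q ^ S_s` of the factor X_s is absorbed into the past variable.
      have h1 := ih ((hY.mono hts).mul_pow_compoundPoisson hN.mono hN.zero hq0.le hq1.le)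
      have h2 : ∀ f : Ω → ℝ, ∫ ω, Y ω * (X ω s * f ω) ∂P =
          (∫ ω, Y ω * q ^ compoundPoisson N Z s ω * f ω ∂P) *
            Real.exp (-(driftQ q mu * s)) := by
        intro f
        rw [← integral_mul_const]
        congr 1
        ext ω
        rw [hX, expIntegrand_eq hq0, Real.toNNReal_coe]
        ring
      rw [h2, h1, mul_assoc, ← h2, mul_assoc]
      congr 1
      simp_rw [← pow_succ']
      exact hY.integral_mul_expIntegrand_pow hNZ hN hq0 hq1 hs.le (n + 1)
    have hpath : ∀ ω, Y ω * J ω t ^ (n + 1) =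
        (n + 1) * ∫ s in Ioi (t : ℝ), Y ω * (X ω s * J ω s ^ n) := by
      intro ω
      have := tailIntegral_pow_succ (integrableOn_expIntegrand hN hm hZ hq0 hq1 hmu ω t)
        (fun s => (expIntegrand_pos hq0 _ ω s).le)
        (continuousWithinAt_expIntegrand (mu := mu) (Z := Z) hN hq0 ω) n
      rw [integral_const_mul]
      calc Y ω * J ω t ^ (n + 1) = Y ω * ((n + 1) * ∫ s in Ioi (t : ℝ), X ω s * J ω s ^ n) := by
            exact congrArg (Y ω * ·) this
        _ = _ := by ring
    have hint : Integrable (Function.uncurry fun ω s => Y ω * (X ω s * J ω s ^ n))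
        (P.prod (volume.restrict (Ioi (t : ℝ)))) := by
      -- Dominating function for Fubini, from |Y| ≤ 1, X_s ≤ exp(-c s) and J_s ≤ 1/c.
      have hb : Integrable (fun s => Real.exp (-driftQ q mu * s) * (1 / driftQ q mu) ^ n)
          (volume.restrict (Ioi (t : ℝ))) := (exp_neg_integrableOn_Ioi _ hc).mul_const _
      refine (hb.comp_snd P).mono' ?_ ?_
      · exact (((hY.measurable hm hZ).comp measurable_fst).mul
          ((measurable_expIntegrand_uncurry hN hm hZ).mul
            ((measurable_expTail_uncurry hN hm hZ).pow_const n))).aestronglyMeasurable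
      · filter_upwards [Measure.quasiMeasurePreserving_snd.ae
          (ae_restrict_mem (μ := volume) (measurableSet_Ioi (a := (t : ℝ))))] with y hy
        have hJ0 := expTail_nonneg (mu := mu) hq0 (compoundPoisson N Z) y.1 y.2
        rw [Function.uncurry, norm_mul, norm_mul, norm_pow, Real.norm_of_nonneg hJ0,
          Real.norm_of_nonneg (expIntegrand_pos hq0 _ _ _).le, Real.norm_eq_abs]
        refine (mul_le_of_le_one_left (mul_nonneg (expIntegrand_pos hq0 _ _ _).le
          (pow_nonneg hJ0 _)) (hY.abs_le_one _)).trans ?_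
        refine mul_le_mul ?_ (pow_le_pow_left₀ hJ0
          (expTail_le hN hm hZ hq0 hq1 hmu _ (t.2.trans (le_of_lt hy))) n) (pow_nonneg hJ0 _)
          (Real.exp_pos _).le
        simpa only [← neg_mul] using expIntegrand_le hq0 hq1 _ _ _
    have hexp : ∫ s in Ioi (t : ℝ), Real.exp (-(Φ * (s - t))) = 1 / Φ := by
      have h1 : ∀ s, Real.exp (-(Φ * (s - t))) = Real.exp (Φ * t) * Real.exp (-Φ * s) := by
        intro s
        rw [← Real.exp_add]
        congr 1; ring
      simp_rw [h1]
      rw [integral_const_mul, integral_exp_mul_Ioi (by linarith [hΦ n]), neg_div_neg_eq,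
        ← mul_div_assoc, ← Real.exp_add]
      simp
    simp_rw [hpath]
    rw [integral_const_mul, integral_integral_swap hint, setIntegral_congr_fun measurableSet_Ioi
      (fun s hs => hstep s hs), integral_const_mul, hexp, Finset.prod_range_succ]
    ring

end Moments

/-! ### Regular versions of the paths and the moment recursion -/

section Regularisation

open Set Filter Topology

variable {Ω : Type*} [MeasurableSpace Ω] {P : Measure Ω} {lam : ℝ≥0}
  {N : ℝ≥0 → Ω → ℕ} {Z : ℕ → Ω → ℕ} {q mu : ℝ}

/-- A compound Poisson process has a version, indistinguishable from it, with regular paths. -/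
theorem IsCompoundPoissonData.exists_hasRegularPaths (hNZ : IsCompoundPoissonData P lam N Z) :
    ∃ N' : ℝ≥0 → Ω → ℕ, IsCompoundPoissonData P lam N' Z ∧ HasRegularPaths N' ∧
      ∀ᵐ ω ∂P, ∀ t, N t ω = N' t ω := by
  classical
  have hgood := hNZ.poisson.zero.and (hNZ.poisson.mono.and hNZ.poisson.rightCts)
  -- The set of good paths need not be measurable, so it is shrunk to a measurable set of full
  -- measure; off this set the new process is identically `0`.
  obtain ⟨A, hAm, hAsub, hA⟩ := hgood.exists_measurable_mem
  set N' : ℝ≥0 → Ω → ℕ := fun t => A.piecewise (N t) fun _ => 0 with hN'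
  have hmem : ∀ ω ∈ A, ∀ t, N' t ω = N t ω := fun ω hω t => piecewise_eq_of_mem _ _ _ hω
  have hnot : ∀ ω ∉ A, ∀ t, N' t ω = 0 := fun ω hω t => piecewise_eq_of_notMem _ _ _ hω
  have hae : ∀ᵐ ω ∂P, ∀ t, N t ω = N' t ω := by
    filter_upwards [hAm] with ω hω t using (hmem ω hω t).symm
  have hreg : HasRegularPaths N' := by
    refine ⟨fun ω => ?_, fun ω => ?_, fun ω t => ?_⟩ <;> by_cases hω : ω ∈ A
    · rw [hmem ω hω]; exact (hA ω hω).1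
    · exact hnot ω hω 0
    · simpa only [hmem ω hω] using (hA ω hω).2.1
    · simpa only [hnot ω hω] using monotone_const
    · simpa only [hmem ω hω] using (hA ω hω).2.2 t
    · simpa only [hnot ω hω] using continuousWithinAt_const
  refine ⟨N', ⟨⟨fun t => (hNZ.poisson.measurable t).piecewise hAsub measurable_const,
    .of_forall hreg.zero, .of_forall hreg.mono, .of_forall hreg.rightCts, fun n t ht => ?_,
    fun s t hst => ?_⟩, hNZ.measurable, hNZ.iIndep, hNZ.identDistrib, ?_⟩, hreg, hae⟩
  · refine (hNZ.poisson.indepIncrements n t ht).congr fun i => ?_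
    filter_upwards [hae] with ω hω
    rw [hω, hω]
  · refine (hNZ.poisson.law s t hst).congr ?_
    filter_upwards [hae] with ω hω
    rw [hω, hω]
  · refine hNZ.indep.congr ?_ .rfl
    filter_upwards [hae] with ω hω
    exact funext hω

theorem measurable_expFunctional (hN : HasRegularPaths N) (hm : ∀ t, Measurable (N t))
    (hZ : ∀ i, Measurable (Z i)) :
    Measurable (expFunctional q mu (compoundPoisson N Z)) :=
  (measurable_expTail_uncurry hN hm hZ).comp (measurable_prodMk_right (y := (0 : ℝ)))

theorem expFunctional_mem_Icc (hN : HasRegularPaths N) (hm : ∀ t, Measurable (N t))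
    (hZ : ∀ i, Measurable (Z i)) (hq0 : 0 < q) (hq1 : q < 1) (hmu : 0 < mu) (ω : Ω) :
    expFunctional q mu (compoundPoisson N Z) ω ∈ Icc 0 (1 / driftQ q mu) :=
  ⟨expTail_nonneg hq0 _ ω 0, expTail_le hN hm hZ hq0 hq1 hmu ω le_rfl⟩

variable [IsProbabilityMeasure P]

theorem jumpGen_le_one (hq0 : 0 < q) (hq1 : q < 1) (n : ℕ) :
    jumpGen P Z q n ≤ 1 := by
  have hx0 := pow_nonneg hq0.le n
  have hx1 := pow_le_one₀ (n := n) hq0.le hq1.le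
  calc jumpGen P Z q n ≤ ∫ _, (1 : ℝ) ∂P := by
        refine integral_mono_of_nonneg (.of_forall fun ω => pow_nonneg hx0 _)
          (integrable_const _) (.of_forall fun ω => pow_le_one₀ hx0 hx1)
    _ = 1 := by simp

theorem laplaceExp_pos (hq0 : 0 < q) (hq1 : q < 1) (hmu : 0 < mu)
    (lam : ℝ≥0) (n : ℕ) :
    0 < laplaceExp (driftQ q mu) lam (jumpGen P Z q) (n + 1) := by
  have h1 := jumpGen_le_one (P := P) (Z := Z) hq0 hq1 (n + 1)
  have hc := driftQ_pos hq0 hq1 hmu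
  have h2 := mul_nonneg lam.2 (sub_nonneg.2 h1)
  have h3 : 0 < ((n + 1 : ℕ) : ℝ) * driftQ q mu := by positivity
  exact add_pos_of_pos_of_nonneg h3 h2

/-- The moment recursion for the exponential functional. -/
theorem laplaceExp_mul_moment (hNZ : IsCompoundPoissonData P lam N Z) (hN : HasRegularPaths N)
    (hq0 : 0 < q) (hq1 : q < 1) (hmu : 0 < mu) (n : ℕ) :
    laplaceExp (driftQ q mu) lam (jumpGen P Z q) (n + 1) *
        ∫ ω, expFunctional q mu (compoundPoisson N Z) ω ^ (n + 1) ∂P =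
      (n + 1) * ∫ ω, expFunctional q mu (compoundPoisson N Z) ω ^ n ∂P := by
  have hΦ := laplaceExp_pos (P := P) (Z := Z) hq0 hq1 hmu lam
  have h : ∀ n, ∫ ω, expFunctional q mu (compoundPoisson N Z) ω ^ n ∂P =
      ∏ k ∈ Finset.range n, ((k : ℝ) + 1) /
        laplaceExp (driftQ q mu) lam (jumpGen P Z q) (k + 1) := by
    intro n
    have h1 := isPast_one.integral_mul_expTail_pow hNZ hN hq0 hq1 hmu hΦ n
    -- At time `0` no jump has occurred, so X_0 = 1 and only the product survives.
    simpa [expTail, expFunctional, expIntegrand_eq hq0, compoundPoisson, hN.zero] using h1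
  rw [h, h, Finset.prod_range_succ]
  field_simp [(hΦ n).ne']

end Regularisation

/-! ### Determinacy of moments on a compact interval, and layer cake -/

section MomentProblem

open Set Filter Topology

theorem integrable_pow_of_ae_mem_Icc {μ : Measure ℝ} [IsFiniteMeasure μ] {a b : ℝ}
    (h : ∀ᵐ x ∂μ, x ∈ Icc a b) (n : ℕ) : Integrable (fun x => x ^ n) μ := by
  refine Integrable.of_bound (by fun_prop) (max |a| |b| ^ n) ?_
  filter_upwards [h] with x hx
  rw [norm_pow, Real.norm_eq_abs]
  exact pow_le_pow_left₀ (abs_nonneg x) (abs_le_max_abs_abs hx.1 hx.2) n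

/-- Finite measures on a compact interval are determined by their moments. -/
theorem ext_of_moments {μ₁ μ₂ : Measure ℝ} [IsFiniteMeasure μ₁] [IsFiniteMeasure μ₂] {a b : ℝ}
    (h₁ : ∀ᵐ x ∂μ₁, x ∈ Icc a b) (h₂ : ∀ᵐ x ∂μ₂, x ∈ Icc a b)
    (h : ∀ n : ℕ, ∫ x, x ^ n ∂μ₁ = ∫ x, x ^ n ∂μ₂) : μ₁ = μ₂ := by
  have hpint : ∀ {μ : Measure ℝ} [IsFiniteMeasure μ], (∀ᵐ x ∂μ, x ∈ Icc a b) →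
      ∀ p : Polynomial ℝ, Integrable (fun x => p.eval x) μ := by
    intro μ _ hμ p
    simp_rw [Polynomial.eval_eq_sum_range]
    exact integrable_finsetSum _ fun i _ => (integrable_pow_of_ae_mem_Icc hμ i).const_mul _
  have hp : ∀ p : Polynomial ℝ, ∫ x, p.eval x ∂μ₁ = ∫ x, p.eval x ∂μ₂ := by
    intro p
    simp_rw [Polynomial.eval_eq_sum_range]
    rw [integral_finsetSum _ fun i _ => (integrable_pow_of_ae_mem_Icc h₁ i).const_mul _,
      integral_finsetSum _ fun i _ => (integrable_pow_of_ae_mem_Icc h₂ i).const_mul _]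
    simp_rw [integral_const_mul, h]
  refine ext_of_forall_integral_eq_of_IsFiniteMeasure fun f => ?_
  have hb : ∀ {μ : Measure ℝ} [IsFiniteMeasure μ], (∀ᵐ x ∂μ, x ∈ Icc a b) → ∀ ε > 0,
      ∀ p : Polynomial ℝ, (∀ x ∈ Icc a b, |p.eval x - f x| < ε) →
        |∫ x, p.eval x ∂μ - ∫ x, f x ∂μ| ≤ ε * μ.real univ := by
    intro μ _ hμ ε _ p hpf
    rw [← integral_sub (hpint hμ p) (f.integrable μ)]
    rw [← Real.norm_eq_abs]
    refine norm_integral_le_of_norm_le_const ?_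
    filter_upwards [hμ] with x hx using (hpf x hx).le
  by_contra hne
  set d := |∫ x, f x ∂μ₁ - ∫ x, f x ∂μ₂| with hd
  have hd0 : 0 < d := abs_pos.2 (sub_ne_zero.2 hne)
  set m := μ₁.real univ + μ₂.real univ with hm
  have hm0 : 0 ≤ m := by positivity
  -- The two approximation errors add up to at most ε m, which this choice keeps below `d`, also
  -- when `m = 0`.
  have hε : 0 < d / (m + 1) := by positivity
  obtain ⟨p, hpf⟩ := exists_polynomial_near_of_continuousOn a b f f.continuous.continuousOn _ hε
  have e1 := hb h₁ _ hε p hpf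
  have e2 := hb h₂ _ hε p hpf
  rw [hp] at e1
  have e3 : d ≤ d / (m + 1) * m := by
    calc d = |(∫ x, p.eval x ∂μ₂ - ∫ x, f x ∂μ₂) - (∫ x, p.eval x ∂μ₂ - ∫ x, f x ∂μ₁)| := by
          rw [hd]; congr 1; ring
      _ ≤ _ := abs_sub _ _
      _ ≤ d / (m + 1) * m := by rw [hm, mul_add]; linarith
  have e4 : d / (m + 1) * m < d := by
    rw [div_mul_eq_mul_div, div_lt_iff₀ (by positivity)]
    nlinarith
  linarith

theorem antitone_real_Ioi (ν : Measure ℝ) [IsFiniteMeasure ν] :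
    Antitone fun x => ν.real (Ioi x) :=
  fun _ _ hxy => measureReal_mono (Ioi_subset_Ioi hxy)

/-- Layer cake formula for moments. -/
theorem setIntegral_pow_mul_real_Ioi {ν : Measure ℝ} [IsFiniteMeasure ν] {B : ℝ}
    (hν : ∀ᵐ x ∂ν, x ∈ Icc 0 B) (n : ℕ) :
    ∫ x in Ioc 0 B, x ^ n * ν.real (Ioi x) = (∫ x, x ^ (n + 1) ∂ν) / (n + 1) := by
  have h1 : ∀ x, x ^ n * ν.real (Ioi x) =
      ∫ y, (Ioi x).indicator (fun _ => x ^ n) y ∂ν := by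
    intro x
    rw [integral_indicator_const _ measurableSet_Ioi, smul_eq_mul, mul_comm]
  have hmeas : Measurable (Function.uncurry fun x y : ℝ =>
      (Ioi x).indicator (fun _ => x ^ n) y) := by
    have hs : MeasurableSet {z : ℝ × ℝ | z.1 < z.2} := measurableSet_lt measurable_fst measurable_snd
    exact (measurable_fst.pow_const n).indicator hs
  have hint : Integrable (Function.uncurry fun x y : ℝ => (Ioi x).indicator (fun _ => x ^ n) y)
      ((volume.restrict (Ioc 0 B)).prod ν) := by
    refine Integrable.of_bound hmeas.aestronglyMeasurable (B ^ n) ?_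
    filter_upwards [Measure.quasiMeasurePreserving_fst.ae
      (ae_restrict_mem (μ := volume) (measurableSet_Ioc (a := (0 : ℝ)) (b := B)))] with z hz
    refine (norm_indicator_le_norm_self (fun _ : ℝ => z.1 ^ n) z.2).trans ?_
    rw [norm_pow, Real.norm_of_nonneg hz.1.le]
    exact pow_le_pow_left₀ hz.1.le hz.2 n
  simp_rw [h1]
  rw [integral_integral_swap hint, ← integral_div]
  refine integral_congr_ae ?_
  filter_upwards [hν] with y hy
  have h2 : ∀ x, (Ioi x).indicator (fun _ => x ^ n) y = (Iio y).indicator (fun x => x ^ n) x := by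
    intro x
    simp [indicator_apply]
  simp_rw [h2]
  have h3 : Ioc 0 B ∩ Iio y = Ioo 0 y := by
    ext x
    exact ⟨fun hx => ⟨hx.1.1, hx.2⟩, fun hx => ⟨⟨hx.1, hx.2.le.trans hy.2⟩, hx.2⟩⟩
  rw [setIntegral_indicator measurableSet_Iio, h3, ← integral_Ioc_eq_integral_Ioo,
    ← intervalIntegral.integral_of_le hy.1, integral_pow]
  simp

end MomentProblem

/-! ### From the moment recursion to an identity of measures -/

section Density

open Set Filter Topology

/-- The law `ν` lives on `[0, 1 / c]` and its moments satisfy the recursion of the exponential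
functional with drift `c`, intensity `lam` and jump law `κ`. -/
structure HasExpMoments (q c lam : ℝ) (κ : Measure ℕ) (ν : Measure ℝ) : Prop where
  support : ∀ᵐ x ∂ν, x ∈ Icc 0 (1 / c)
  moment : ∀ n : ℕ, ((n + 1) * c + lam * (1 - ∫ k, (q ^ (n + 1)) ^ k ∂κ)) * ∫ x, x ^ (n + 1) ∂ν =
    (n + 1) * ∫ x, x ^ n ∂ν

variable {q c lam : ℝ} {κ : Measure ℕ} {ν : Measure ℝ}

/-- The law of `q ^ Z * I` for independent `Z` of law `κ` and `I` of law `ν`. -/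
noncomputable def scaledLaw (q : ℝ) (κ : Measure ℕ) (ν : Measure ℝ) : Measure ℝ :=
  (κ.prod ν).map fun y => q ^ y.1 * y.2

theorem measurable_pow_mul (q : ℝ) : Measurable fun y : ℕ × ℝ => q ^ y.1 * y.2 :=
  measurable_from_prod_countable_right fun k => measurable_const_mul (q ^ k)

theorem scaledLaw_support [SFinite ν] (hq0 : 0 < q) (hq1 : q < 1) {b : ℝ}
    (h : ∀ᵐ x ∂ν, x ∈ Icc 0 b) : ∀ᵐ x ∂scaledLaw q κ ν, x ∈ Icc 0 b := by
  refine (ae_map_iff (p := fun x => x ∈ Icc 0 b) (measurable_pow_mul q).aemeasurable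
    measurableSet_Icc).2 ?_
  filter_upwards [Measure.quasiMeasurePreserving_snd.ae h] with y hy
  exact ⟨mul_nonneg (pow_nonneg hq0.le _) hy.1,
    (mul_le_of_le_one_left hy.1 (pow_le_one₀ hq0.le hq1.le)).trans hy.2⟩

/-- Independence factors the moments; this is how E q^(n Z) in the recursion becomes a statement
about a measure. -/
theorem integral_pow_scaledLaw [SFinite κ] [SFinite ν] (q : ℝ) (n : ℕ) :
    ∫ x, x ^ n ∂scaledLaw q κ ν = (∫ k, (q ^ n) ^ k ∂κ) * ∫ x, x ^ n ∂ν := by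
  rw [scaledLaw, integral_map (measurable_pow_mul q).aemeasurable (by fun_prop),
    ← integral_prod_mul]
  simp_rw [mul_pow, ← pow_mul, mul_comm]

variable [IsProbabilityMeasure κ] [IsProbabilityMeasure ν]

instance : IsProbabilityMeasure (scaledLaw q κ ν) :=
  Measure.isProbabilityMeasure_map (measurable_pow_mul q).aemeasurable

theorem scaledLaw_real_Ioi (hq0 : 0 < q) (x : ℝ) :
    (scaledLaw q κ ν).real (Ioi x) = ∑' k, κ.real {k} * ν.real (Ioi ((q ^ k)⁻¹ * x)) := by
  have hs : MeasurableSet ((fun y : ℕ × ℝ => q ^ y.1 * y.2) ⁻¹' Ioi x) :=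
    measurable_pow_mul q measurableSet_Ioi
  have hfib : ∀ k : ℕ, Prod.mk k ⁻¹' ((fun y : ℕ × ℝ => q ^ y.1 * y.2) ⁻¹' Ioi x) =
      Ioi ((q ^ k)⁻¹ * x) := by
    intro k
    ext y
    simp only [mem_preimage, mem_Ioi]
    rw [inv_mul_lt_iff₀ (pow_pos hq0 k)]
  have h1 : (scaledLaw q κ ν).real (Ioi x) = ∫ k, ν.real (Ioi ((q ^ k)⁻¹ * x)) ∂κ := by
    rw [measureReal_def, scaledLaw, Measure.map_apply (measurable_pow_mul q) measurableSet_Ioi,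
      Measure.prod_apply hs]
    simp_rw [hfib]
    rw [← integral_toReal]
    · rfl
    · exact AEMeasurable.of_discrete
    · exact .of_forall fun k => measure_lt_top _ _
  rw [h1, integral_countable]
  · rfl
  · exact Integrable.of_bound .of_discrete 1 (.of_forall fun k => by
      rw [Real.norm_of_nonneg measureReal_nonneg]; exact measureReal_le_one)

theorem measurable_real_Ioi (ν : Measure ℝ) [IsFiniteMeasure ν] :
    Measurable fun x => ν.real (Ioi x) :=
  (antitone_real_Ioi ν).measurable

theorem real_Ioi_eq_zero {b : ℝ} (h : ∀ᵐ x ∂ν, x ∈ Icc 0 b) {x : ℝ} (hx : b ≤ x) :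
    ν.real (Ioi x) = 0 := by
  rw [measureReal_eq_zero_iff]
  refine measure_mono_null (fun y hy => ?_) (ae_iff.1 h)
  exact fun hy' => absurd (hx.trans_lt hy) (not_lt.2 hy'.2)

/-- For I ≥ 0 one has q^Z I ≤ I. This is the source of the nonnegativity of the density. -/
theorem scaledLaw_real_Ioi_le (hq0 : 0 < q) (hq1 : q < 1) (h : ∀ᵐ x ∂ν, 0 ≤ x) (x : ℝ) :
    (scaledLaw q κ ν).real (Ioi x) ≤ ν.real (Ioi x) := by
  rcases lt_or_ge x 0 with hx | hx
  · have : ν (Ioi x) = 1 := by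
      rw [prob_compl_eq_zero_iff measurableSet_Ioi |>.symm]
      refine measure_mono_null (fun y hy => ?_) (ae_iff.1 h)
      exact fun hy' => hy (hx.trans_le hy')
    rw [measureReal_def ν, this]
    exact measureReal_le_one
  · rw [scaledLaw, measureReal_def, Measure.map_apply (measurable_pow_mul q) measurableSet_Ioi]
    calc ((κ.prod ν) ((fun y : ℕ × ℝ => q ^ y.1 * y.2) ⁻¹' Ioi x)).toReal
        ≤ ((κ.prod ν) (univ ×ˢ Ioi x)).toReal := by
          refine measureReal_mono fun y hy => ⟨mem_univ _, ?_⟩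
          by_contra hy2
          have hy2 : y.2 ≤ x := not_lt.1 hy2
          have hy1 : x < q ^ y.1 * y.2 := hy
          have h0 : 0 < y.2 := by
            by_contra h0
            nlinarith [pow_pos hq0 y.1, not_lt.1 h0,
              mul_nonpos_of_nonneg_of_nonpos (pow_pos hq0 y.1).le (not_lt.1 h0)]
          linarith [mul_le_of_le_one_left h0.le (pow_le_one₀ (n := y.1) hq0.le hq1.le)]
      _ = ν.real (Ioi x) := by rw [Measure.prod_prod]; simp [measureReal_def]

theorem integral_withDensity_ofReal {μ : Measure ℝ} {f : ℝ → ℝ} (hf : Measurable f)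
    (h0 : ∀ᵐ x ∂μ, 0 ≤ f x) (g : ℝ → ℝ) :
    ∫ x, g x ∂μ.withDensity (fun x => ENNReal.ofReal (f x)) = ∫ x, f x * g x ∂μ := by
  rw [integral_withDensity_eq_integral_toReal_smul (by fun_prop) (by simp)]
  refine integral_congr_ae ?_
  filter_upwards [h0] with x hx
  rw [ENNReal.toReal_ofReal hx, smul_eq_mul]

/-- The law of the exponential functional, weighted by `1 - c x`, has density
`lam * (P(I > x) - P(q ^ Z * I > x))`. -/
theorem HasExpMoments.withDensity_eq (h : HasExpMoments q c lam κ ν) (hc : 0 < c)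
    (hlam : 0 ≤ lam) (hq0 : 0 < q) (hq1 : q < 1) :
    ν.withDensity (fun x => ENNReal.ofReal (1 - c * x)) =
      (volume.restrict (Ioc 0 (1 / c))).withDensity fun x =>
        ENNReal.ofReal (lam * (ν.real (Ioi x) - (scaledLaw q κ ν).real (Ioi x))) := by
  set ρ := scaledLaw q κ ν with hρ
  set ℓ : Measure ℝ := volume.restrict (Ioc 0 (1 / c)) with hℓ
  have hρs : ∀ᵐ x ∂ρ, x ∈ Icc 0 (1 / c) := scaledLaw_support hq0 hq1 h.support
  have hℓs : ∀ᵐ x ∂ℓ, x ∈ Icc 0 (1 / c) := by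
    filter_upwards [ae_restrict_mem measurableSet_Ioc] with x hx using Ioc_subset_Icc_self hx
  have hle := scaledLaw_real_Ioi_le (κ := κ) hq0 hq1 (h.support.mono fun x hx => hx.1)
  have hGm := measurable_real_Ioi ν
  have hHm := measurable_real_Ioi ρ
  have hpos : ∀ᵐ x ∂ν, 0 ≤ 1 - c * x := by
    filter_upwards [h.support] with x hx
    have := (le_div_iff₀ hc).1 hx.2
    linarith
  have hbd : ∀ (η : Measure ℝ) [IsProbabilityMeasure η],
      Integrable (fun x => lam * η.real (Ioi x)) ℓ := fun η _ => by
    refine Integrable.of_bound ((measurable_real_Ioi η).const_mul lam).aestronglyMeasurable lam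
      (.of_forall fun x => ?_)
    rw [Real.norm_of_nonneg (mul_nonneg hlam measureReal_nonneg)]
    exact mul_le_of_le_one_right hlam measureReal_le_one
  have hfin1 : IsFiniteMeasure (ν.withDensity fun x => ENNReal.ofReal (1 - c * x)) := by
    refine isFiniteMeasure_withDensity_ofReal (Integrable.hasFiniteIntegral ?_)
    have := integrable_pow_of_ae_mem_Icc h.support 1
    simp only [pow_one] at this
    exact (integrable_const _).sub (this.const_mul c)
  have hfin2 := isFiniteMeasure_withDensity_ofReal (hbd ρ).hasFiniteIntegral
  have hfin3 := isFiniteMeasure_withDensity_ofReal (hbd ν).hasFiniteIntegral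
  have hsupp1 : ∀ᵐ x ∂(ν.withDensity fun x => ENNReal.ofReal (1 - c * x)), x ∈ Icc 0 (1 / c) :=
    (withDensity_absolutelyContinuous _ _).ae_le h.support
  have hsupp2 : ∀ f : ℝ → ENNReal, ∀ᵐ x ∂(ℓ.withDensity f), x ∈ Icc 0 (1 / c) :=
    fun f => (withDensity_absolutelyContinuous _ _).ae_le hℓs
  have hmom : ∀ (η : Measure ℝ) [IsProbabilityMeasure η], (∀ᵐ x ∂η, x ∈ Icc 0 (1 / c)) → ∀ n : ℕ,
      ∫ x, x ^ n ∂(ℓ.withDensity fun x => ENNReal.ofReal (lam * η.real (Ioi x))) =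
        lam * ((∫ x, x ^ (n + 1) ∂η) / (n + 1)) := by
    intro η _ hη n
    rw [integral_withDensity_ofReal ((measurable_real_Ioi η).const_mul lam)
      (.of_forall fun x => mul_nonneg hlam measureReal_nonneg),
      ← setIntegral_pow_mul_real_Ioi hη, ← integral_const_mul]
    congr 1
    ext x
    ring
  -- The negative term is moved to the left, so that both sides are finite positive measures and
  -- moments can be compared; it is cancelled again at the end.
  have key : (ν.withDensity fun x => ENNReal.ofReal (1 - c * x)) +
      ℓ.withDensity (fun x => ENNReal.ofReal (lam * ρ.real (Ioi x))) =
      ℓ.withDensity fun x => ENNReal.ofReal (lam * ν.real (Ioi x)) := by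
    refine ext_of_moments (a := 0) (b := 1 / c) (ae_add_measure_iff.2 ⟨hsupp1, hsupp2 _⟩)
      (hsupp2 _) fun n => ?_
    rw [integral_add_measure (integrable_pow_of_ae_mem_Icc hsupp1 n)
      (integrable_pow_of_ae_mem_Icc (hsupp2 _) n), hmom ν h.support, hmom ρ hρs,
      integral_withDensity_ofReal (by fun_prop) hpos, hρ, integral_pow_scaledLaw]
    have e1 : ∫ x, (1 - c * x) * x ^ n ∂ν = ∫ x, x ^ n ∂ν - c * ∫ x, x ^ (n + 1) ∂ν := by
      rw [← integral_const_mul, ← integral_sub (integrable_pow_of_ae_mem_Icc h.support n)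
        ((integrable_pow_of_ae_mem_Icc h.support (n + 1)).const_mul c)]
      congr 1
      ext x
      ring
    have e2 := h.moment n
    have e3 : ((n : ℝ) + 1) ≠ 0 := by positivity
    have e4 : ∫ x, x ^ n ∂ν =
        ((n + 1) * c + lam * (1 - ∫ k, (q ^ (n + 1)) ^ k ∂κ)) * (∫ x, x ^ (n + 1) ∂ν) / (n + 1) := by
      rw [e2]
      field_simp
    rw [e1, e4]
    field_simp
    ring
  have hadd : ℓ.withDensity (fun x => ENNReal.ofReal (lam * ν.real (Ioi x))) =
      ℓ.withDensity (fun x => ENNReal.ofReal (lam * (ν.real (Ioi x) - ρ.real (Ioi x)))) +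
      ℓ.withDensity (fun x => ENNReal.ofReal (lam * ρ.real (Ioi x))) := by
    rw [← withDensity_add_left (by fun_prop)]
    congr 1
    ext x
    rw [Pi.add_apply, ← ENNReal.ofReal_add (mul_nonneg hlam (sub_nonneg.2 (hle x)))
      (mul_nonneg hlam measureReal_nonneg)]
    congr 1
    ring
  rw [hadd] at key
  exact (Measure.add_left_inj _ _ _).1 key

/-- The exponential functional has no atom at its maximal value. -/
theorem HasExpMoments.measure_singleton (h : HasExpMoments q c lam κ ν) (hc : 0 < c)
    (hlam : 0 < lam) (hq0 : 0 < q) (hq1 : q < 1) (hκ : 0 < κ.real {k | 1 ≤ k}) :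
    ν {1 / c} = 0 := by
  rw [← measureReal_eq_zero_iff]
  by_contra hne
  set p := ν.real {1 / c} with hp
  have hp0 : 0 < p := lt_of_le_of_ne measureReal_nonneg (Ne.symm hne)
  set m : ℕ → ℝ := fun n => ∫ x, x ^ n ∂ν with hm
  have hqint : ∀ n : ℕ, Integrable (fun k : ℕ => (q ^ n) ^ k) κ := fun n =>
    Integrable.of_bound .of_discrete 1 (.of_forall fun k => by
      rw [Real.norm_of_nonneg (by positivity)]
      exact pow_le_one₀ (pow_nonneg hq0.le n) (pow_le_one₀ hq0.le hq1.le))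
  -- A bound uniform in `n`: 1 - q^((n+1) k) ≥ 1 - q as soon as k ≥ 1.
  set δ := (1 - q) * κ.real {k | 1 ≤ k} with hδ
  have hδ0 : 0 < δ := mul_pos (by linarith) hκ
  have hgen : ∀ n : ℕ, δ ≤ 1 - ∫ k, (q ^ (n + 1)) ^ k ∂κ := by
    intro n
    have e1 : 1 - ∫ k, (q ^ (n + 1)) ^ k ∂κ = ∫ k, (1 - (q ^ (n + 1)) ^ k) ∂κ := by
      rw [integral_sub (integrable_const _) (hqint _)]; simp
    have e2 : δ = ∫ k, ({k | 1 ≤ k} : Set ℕ).indicator (fun _ => 1 - q) k ∂κ := by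
      rw [integral_indicator_const _ (MeasurableSet.of_discrete), smul_eq_mul, mul_comm]
    rw [e1, e2]
    refine integral_mono ((integrable_const _).indicator .of_discrete)
      ((integrable_const _).sub (hqint _)) fun k => ?_
    simp only [indicator_apply, mem_ofPred_eq]
    split_ifs with hk
    · rw [← pow_mul]
      have : q ^ ((n + 1) * k) ≤ q ^ 1 := pow_le_pow_of_le_one hq0.le hq1.le
        (Nat.one_le_iff_ne_zero.2 (by positivity))
      linarith
    · exact sub_nonneg.2 (pow_le_one₀ (pow_nonneg hq0.le _) (pow_le_one₀ hq0.le hq1.le))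
  -- The function (c x)^n equals 1 at the atom, which therefore contributes its whole mass for every
  -- `n`.
  have hpm : ∀ n, p ≤ c ^ n * m n := by
    intro n
    have e1 : p = ∫ x, ({1 / c} : Set ℝ).indicator (fun _ => (1 : ℝ)) x ∂ν := by
      rw [integral_indicator_const _ (measurableSet_singleton _), smul_eq_mul, mul_one]
    rw [e1, hm, ← integral_const_mul]
    refine integral_mono_ae ((integrable_const _).indicator (measurableSet_singleton _))
      ((integrable_pow_of_ae_mem_Icc h.support n).const_mul _) ?_
    filter_upwards [h.support] with x hx
    simp only [indicator_apply, mem_singleton_iff]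
    split_ifs with hx1
    · rw [hx1, ← mul_pow, mul_one_div_cancel hc.ne', one_pow]
    · exact mul_nonneg (pow_nonneg hc.le _) (pow_nonneg hx.1 _)
  -- The recursion rewrites the drop of c^n m_n as λ (1 - E q^((n+1) Z)) c^(n+1) m_{n+1} / (c
  -- (n+1)). The drops telescope to at most 1, whereas the lower bounds form a divergent harmonic
  -- series.
  have hstep : ∀ n : ℕ, p * lam * δ / c * (1 / (n + 1)) ≤
      c ^ n * m n - c ^ (n + 1) * m (n + 1) := by
    intro n
    have e1 := h.moment n
    have e3 : (0 : ℝ) < (n : ℝ) + 1 := by positivity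
    have e2 : c ^ n * m n - c ^ (n + 1) * m (n + 1) =
        lam * (1 - ∫ k, (q ^ (n + 1)) ^ k ∂κ) * (c ^ (n + 1) * m (n + 1)) / c * (1 / (n + 1)) := by
      have e4 : m n = ((n + 1) * c + lam * (1 - ∫ k, (q ^ (n + 1)) ^ k ∂κ)) * m (n + 1) / (n + 1) := by
        rw [hm]; simp only; rw [e1]; field_simp
      rw [e4]
      field_simp
      ring
    rw [e2]
    have e5 := mul_le_mul (hgen n) (hpm (n + 1)) hp0.le (hδ0.le.trans (hgen n))
    have e6 : p * lam * δ ≤ lam * (1 - ∫ k, (q ^ (n + 1)) ^ k ∂κ) * (c ^ (n + 1) * m (n + 1)) := by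
      nlinarith
    gcongr
  have hsum : ∀ K, p * lam * δ / c * ∑ n ∈ Finset.range K, (1 / ((n : ℝ) + 1)) ≤ 1 := by
    intro K
    rw [Finset.mul_sum]
    refine (Finset.sum_le_sum fun n _ => hstep n).trans ?_
    rw [Finset.sum_range_sub' (fun n => c ^ n * m n)]
    have := hpm K
    have e0 : m 0 = 1 := by simp [hm]
    simp only [pow_zero, e0, one_mul]
    linarith
  have hpos : 0 < p * lam * δ / c := by positivity
  obtain ⟨K, hK⟩ := (tendsto_atTop.1 (Real.tendsto_sum_range_one_div_nat_succ_atTop.const_mul_atTop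
    hpos) 2).exists
  linarith [hsum K]

end Density

/-! ### The density, its regularity and its equation -/

section DensityEquation

open Set Filter Topology

variable {q c lam : ℝ} {κ : Measure ℕ} {ν : Measure ℝ}

/-- The density of the exponential functional in terms of its tail function. -/
noncomputable def expDensity (q c lam : ℝ) (κ : Measure ℕ) (ν : Measure ℝ) : ℝ → ℝ :=
  (Ioo 0 (1 / c)).indicator fun x =>
    lam * (ν.real (Ioi x) - (scaledLaw q κ ν).real (Ioi x)) / (1 - c * x)

theorem real_eq_setIntegral_of_eq_withDensity {φ : ℝ → ℝ} (hm : Measurable φ) (h0 : ∀ x, 0 ≤ φ x)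
    (hν : ν = volume.withDensity fun x => ENNReal.ofReal (φ x)) {s : Set ℝ}
    (hs : MeasurableSet s) : ν.real s = ∫ x in s, φ x := by
  rw [integral_eq_lintegral_of_nonneg_ae (.of_forall h0) hm.aestronglyMeasurable,
    ← withDensity_apply _ hs, ← hν]
  rfl

variable [IsProbabilityMeasure κ] [IsProbabilityMeasure ν]

theorem one_sub_mul_pos (hc : 0 < c) {x : ℝ} (hx : x < 1 / c) : 0 < 1 - c * x := by
  have := (lt_div_iff₀ hc).1 hx
  linarith

theorem measurable_expDensity : Measurable (expDensity q c lam κ ν) :=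
  Measurable.indicator (((measurable_real_Ioi ν).sub (measurable_real_Ioi _)).const_mul lam |>.div
    (by fun_prop)) measurableSet_Ioo

theorem HasExpMoments.expDensity_nonneg (h : HasExpMoments q c lam κ ν) (hc : 0 < c)
    (hlam : 0 ≤ lam) (hq0 : 0 < q) (hq1 : q < 1) (x : ℝ) : 0 ≤ expDensity q c lam κ ν x := by
  refine indicator_nonneg (fun x hx => ?_) x
  have := scaledLaw_real_Ioi_le (κ := κ) hq0 hq1 (h.support.mono fun x hx => hx.1) x
  exact div_nonneg (mul_nonneg hlam (sub_nonneg.2 this)) (one_sub_mul_pos hc hx.2).le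

/-- Divide the identity of measures by 1 - c x, which is positive `ν`-almost everywhere because `ν`
has no atom at 1/c. -/
theorem HasExpMoments.eq_withDensity (h : HasExpMoments q c lam κ ν) (hc : 0 < c)
    (hlam : 0 < lam) (hq0 : 0 < q) (hq1 : q < 1) (hκ : 0 < κ.real {k | 1 ≤ k}) :
    ν = volume.withDensity fun x => ENNReal.ofReal (expDensity q c lam κ ν x) := by
  have hatom := h.measure_singleton hc hlam hq0 hq1 hκ
  have hne : ∀ᵐ x ∂ν, x ≠ 1 / c := by
    rw [ae_iff]; simpa using hatom
  have hinv := withDensity_inv_same₀ (μ := ν) (f := fun x => ENNReal.ofReal (1 - c * x))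
    (by fun_prop) (by
      filter_upwards [h.support, hne] with x hx hx1
      simpa using one_sub_mul_pos hc (lt_of_le_of_ne hx.2 hx1)) (by simp)
  have hg : Measurable fun x => lam * (ν.real (Ioi x) - (scaledLaw q κ ν).real (Ioi x)) :=
    ((measurable_real_Ioi ν).sub (measurable_real_Ioi _)).const_mul lam
  have hindic : (fun x => ENNReal.ofReal (expDensity q c lam κ ν x)) =
      (Ioo 0 (1 / c)).indicator fun x => ENNReal.ofReal
        (lam * (ν.real (Ioi x) - (scaledLaw q κ ν).real (Ioi x)) / (1 - c * x)) := by
    ext x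
    rw [expDensity, indicator_apply, indicator_apply]
    split_ifs <;> simp
  rw [h.withDensity_eq hc hlam.le hq0 hq1, ← restrict_Ioo_eq_restrict_Ioc, ← withDensity_mul _
      (by fun_prop) (by fun_prop)] at hinv
  rw [hindic, withDensity_indicator measurableSet_Ioo]
  refine hinv.symm.trans (withDensity_congr_ae ?_)
  filter_upwards [ae_restrict_mem measurableSet_Ioo] with x hx
  rw [Pi.mul_apply, ENNReal.ofReal_div_of_pos (one_sub_mul_pos hc hx.2), div_eq_mul_inv]

theorem integrable_of_eq_withDensity {φ : ℝ → ℝ} (hm : Measurable φ) (h0 : ∀ x, 0 ≤ φ x)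
    (hν : ν = volume.withDensity fun x => ENNReal.ofReal (φ x)) : Integrable φ := by
  refine ⟨hm.aestronglyMeasurable, ?_⟩
  rw [hasFiniteIntegral_iff_ofReal (.of_forall h0), ← setLIntegral_univ,
    ← withDensity_apply _ MeasurableSet.univ, ← hν]
  exact measure_lt_top _ _

theorem real_Ioi_sub_real_Ioi {φ : ℝ → ℝ} (hm : Measurable φ) (h0 : ∀ x, 0 ≤ φ x)
    (hν : ν = volume.withDensity fun x => ENNReal.ofReal (φ x)) (x y : ℝ) :
    ν.real (Ioi x) - ν.real (Ioi y) = ∫ u in x..y, φ u := by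
  have hint := integrable_of_eq_withDensity hm h0 hν
  rw [real_eq_setIntegral_of_eq_withDensity hm h0 hν measurableSet_Ioi,
    real_eq_setIntegral_of_eq_withDensity hm h0 hν measurableSet_Ioi,
    intervalIntegral.integral_Ioi_sub_Ioi' hint.integrableOn hint.integrableOn]

theorem continuous_real_Ioi {φ : ℝ → ℝ} (hm : Measurable φ) (h0 : ∀ x, 0 ≤ φ x)
    (hν : ν = volume.withDensity fun x => ENNReal.ofReal (φ x)) :
    Continuous fun x => ν.real (Ioi x) := by
  have hint := integrable_of_eq_withDensity hm h0 hν
  have : (fun x => ν.real (Ioi x)) = fun x => ν.real (Ioi 0) - ∫ u in (0 : ℝ)..x, φ u := by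
    ext x
    rw [← real_Ioi_sub_real_Ioi hm h0 hν]
    ring
  rw [this]
  exact continuous_const.sub (intervalIntegral.continuous_primitive
    (fun a b => hint.intervalIntegrable) 0)

theorem hasDerivAt_real_Ioi {φ : ℝ → ℝ} (hm : Measurable φ) (h0 : ∀ x, 0 ≤ φ x)
    (hν : ν = volume.withDensity fun x => ENNReal.ofReal (φ x)) {x : ℝ} (hx : ContinuousAt φ x) :
    HasDerivAt (fun x => ν.real (Ioi x)) (-φ x) x := by
  have hint := integrable_of_eq_withDensity hm h0 hν
  have : (fun x => ν.real (Ioi x)) = fun x => ν.real (Ioi 0) - ∫ u in (0 : ℝ)..x, φ u := by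
    ext x
    rw [← real_Ioi_sub_real_Ioi hm h0 hν]
    ring
  rw [this]
  exact (intervalIntegral.integral_hasDerivAt_right hint.intervalIntegrable
    hm.stronglyMeasurable.stronglyMeasurableAtFilter hx).const_sub _

theorem summable_real_singleton (κ : Measure ℕ) [IsProbabilityMeasure κ] :
    Summable fun k => κ.real {k} := by
  exact ENNReal.summable_toReal (by
    rw [← measure_iUnion (fun i j hij => by simpa using hij) fun _ => .of_discrete]
    exact measure_ne_top _ _)

theorem continuous_scaledLaw_real_Ioi (hq0 : 0 < q) (hG : Continuous fun x => ν.real (Ioi x)) :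
    Continuous fun x => (scaledLaw q κ ν).real (Ioi x) := by
  simp_rw [scaledLaw_real_Ioi hq0]
  refine continuous_tsum (fun k => continuous_const.mul (hG.comp (continuous_const_mul _)))
    (summable_real_singleton κ) fun k x => ?_
  rw [Real.norm_of_nonneg (mul_nonneg measureReal_nonneg measureReal_nonneg)]
  exact mul_le_of_le_one_right measureReal_nonneg measureReal_le_one

/-- A bootstrap: having a density makes the tail function continuous, the formula for the density
then makes the density continuous inside the interval, and so the tail function is differentiable
there. -/
theorem continuousAt_expDensity (hc : 0 < c) (hq0 : 0 < q)
    (hG : Continuous fun x => ν.real (Ioi x)) {x : ℝ} (hx : x ∈ Ioo 0 (1 / c)) :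
    ContinuousAt (expDensity q c lam κ ν) x := by
  have h1 : ContinuousAt (fun x =>
      lam * (ν.real (Ioi x) - (scaledLaw q κ ν).real (Ioi x)) / (1 - c * x)) x :=
    (continuous_const.mul (hG.sub (continuous_scaledLaw_real_Ioi hq0 hG))).continuousAt.div
      (by fun_prop) (one_sub_mul_pos hc hx.2).ne'
  refine h1.congr ?_
  filter_upwards [isOpen_Ioo.mem_nhds hx] with y hy
  rw [expDensity, indicator_of_mem hy]

/-- The equation for the density in terms of the tail function. -/
theorem HasExpMoments.expDensity_mul (h : HasExpMoments q c lam κ ν) (hc : 0 < c)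
    (hq0 : 0 < q) (hq1 : q < 1) (j : ℕ) {x : ℝ} (hx : x ∈ Ico (q ^ (j + 1) / c) (1 / c)) :
    expDensity q c lam κ ν x * (1 - c * x) =
      lam * (κ.real {k | 1 ≤ k} * ν.real (Ioi x) -
        ∑ k ∈ Finset.range j, κ.real {k + 1} * ν.real (Ioi ((q ^ (k + 1))⁻¹ * x))) := by
  have hx0 : 0 < x := lt_of_lt_of_le (by positivity) hx.1
  have hr : κ.real {0} + κ.real {k | 1 ≤ k} = 1 := by
    have h1 := probReal_add_probReal_compl (μ := κ) (s := {0}) .of_discrete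
    have h2 : ({0} : Set ℕ)ᶜ = {k | 1 ≤ k} := by
      ext k; simp [Nat.one_le_iff_ne_zero]
    rwa [h2] at h1
  have hH : (scaledLaw q κ ν).real (Ioi x) = κ.real {0} * ν.real (Ioi x) +
      ∑ k ∈ Finset.range j, κ.real {k + 1} * ν.real (Ioi ((q ^ (k + 1))⁻¹ * x)) := by
    rw [scaledLaw_real_Ioi hq0, tsum_eq_sum (s := Finset.range (j + 1)), Finset.sum_range_succ']
    · simp [add_comm]
    -- For k ≥ j + 1 the argument q^(-k) x is at least 1/c, beyond the support.
    · intro k hk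
      have hk : j + 1 ≤ k := by simpa using hk
      rw [real_Ioi_eq_zero h.support, mul_zero]
      rw [le_inv_mul_iff₀ (pow_pos hq0 k), mul_one_div]
      refine le_trans ?_ hx.1
      gcongr ?_ / c
      exact pow_le_pow_of_le_one hq0.le hq1.le hk
  rw [expDensity, indicator_of_mem (show x ∈ Ioo 0 (1 / c) from ⟨hx0, hx.2⟩),
    div_mul_cancel₀ _ (one_sub_mul_pos hc hx.2).ne', hH]
  congr 1
  rw [← sub_sub, ← one_sub_mul, ← hr]
  ring

end DensityEquation

/-! ### Integrability in the recurrence -/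

section BasisIntegrability

open Set Filter Topology

variable {q mu lam r : ℝ} {p : ℕ → ℝ}

theorem breakpoint_zero : breakpoint q mu 0 = 1 / driftQ q mu := by
  simp [breakpoint]

theorem breakpoint_pos (hq0 : 0 < q) (hc : 0 < driftQ q mu) (j : ℕ) : 0 < breakpoint q mu j :=
  div_pos (pow_pos hq0 j) hc

theorem breakpoint_antitone (hq0 : 0 < q) (hq1 : q < 1) (hc : 0 < driftQ q mu) :
    Antitone (breakpoint q mu) := fun _ _ hij =>
  div_le_div_of_nonneg_right (pow_le_pow_of_le_one hq0.le hq1.le hij) hc.le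

theorem breakpoint_succ_lt (hq0 : 0 < q) (hq1 : q < 1) (hc : 0 < driftQ q mu) (j : ℕ) :
    breakpoint q mu (j + 1) < breakpoint q mu j :=
  div_lt_div_of_pos_right (pow_lt_pow_right_of_lt_one₀ hq0 hq1 (Nat.lt_succ_self j)) hc

theorem breakpoint_succ_lt_one_div (hq0 : 0 < q) (hq1 : q < 1) (hc : 0 < driftQ q mu) (j : ℕ) :
    breakpoint q mu (j + 1) < 1 / driftQ q mu :=
  (breakpoint_succ_lt hq0 hq1 hc j).trans_le
    (breakpoint_zero (q := q) (mu := mu) ▸ breakpoint_antitone hq0 hq1 hc (Nat.zero_le j))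

theorem inv_pow_mul_breakpoint (hq0 : 0 < q) {k j : ℕ} (hkj : k ≤ j) :
    (q ^ k)⁻¹ * breakpoint q mu j = breakpoint q mu (j - k) := by
  obtain ⟨i, rfl⟩ := Nat.exists_eq_add_of_le hkj
  rw [Nat.add_sub_cancel_left, breakpoint, breakpoint, pow_add]
  field_simp [(pow_pos hq0 k).ne']

theorem continuousOn_one_sub_mul_rpow {c : ℝ} (hc : 0 < c) (s : ℝ) :
    ContinuousOn (fun x => (1 - c * x) ^ s) (Iio (1 / c)) := by
  intro x hx
  exact ((by fun_prop : Continuous fun x => 1 - c * x).continuousAt.rpow_const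
    (Or.inl (one_sub_mul_pos hc hx).ne')).continuousWithinAt

theorem intervalIntegrable_one_sub_mul_rpow {c : ℝ} (hc : 0 < c) {s : ℝ} (hs : -1 < s) (x y : ℝ) :
    IntervalIntegrable (fun x => (1 - c * x) ^ s) volume x y := by
  have h1 : IntervalIntegrable (fun u : ℝ => u ^ s) volume (1 - c * x) (1 - c * y) :=
    intervalIntegral.intervalIntegrable_rpow' hs
  have h2 := (h1.comp_sub_left 1).comp_mul_left (c := c)
  simpa [hc.ne'] using h2

theorem continuousOn_integral_left {f : ℝ → ℝ} {b : ℝ}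
    (hf : ∀ x ≤ b, IntervalIntegrable f volume x b) :
    ContinuousOn (fun x => ∫ y in x..b, f y) (Iic b) := by
  intro x hx
  have hx' : x - 1 ≤ b := by linarith [mem_Iic.1 hx]
  have h1 := intervalIntegral.continuousOn_primitive_interval_left
    (a := x - 1) (b := b) (f := f) (μ := volume) (by
      rw [uIcc_of_le hx', integrableOn_Icc_iff_integrableOn_Ioc]
      exact (intervalIntegrable_iff_integrableOn_Ioc_of_le hx').1 (hf _ hx'))
  rw [uIcc_of_le hx'] at h1
  refine (h1 x ⟨by linarith, hx⟩).mono_of_mem_nhdsWithin ?_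
  rw [← Ici_inter_Iic, inter_comm]
  exact inter_mem_nhdsWithin _ (Ici_mem_nhds (by linarith))

/-- The substitution y ↦ q^(-k) y carries the `j`-th breakpoint to the `(j - k)`-th. The power of 1
- c y stays continuous because j ≥ 1 keeps y away from 1/c. -/
theorem intervalIntegrable_recurrence_aux (hq0 : 0 < q) (hq1 : q < 1) (hc : 0 < driftQ q mu)
    {j k : ℕ} (hk : 1 ≤ k) (hkj : k ≤ j) (s : ℝ) {h : ℝ → ℝ}
    (hh : ∀ x ≤ breakpoint q mu (j - k),
      IntervalIntegrable h volume x (breakpoint q mu (j - k)))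
    {x : ℝ} (hx : x ≤ breakpoint q mu j) :
    IntervalIntegrable (fun y => (1 - driftQ q mu * y) ^ s * h ((q ^ k)⁻¹ * y)) volume x
      (breakpoint q mu j) := by
  have hqk := pow_pos hq0 k
  have h1 : IntervalIntegrable (fun y => h ((q ^ k)⁻¹ * y)) volume x (breakpoint q mu j) := by
    have h2 := hh ((q ^ k)⁻¹ * x) (by
      rw [← inv_pow_mul_breakpoint hq0 hkj]
      gcongr)
    rw [← inv_pow_mul_breakpoint hq0 hkj] at h2
    have h3 := h2.comp_mul_left (c := (q ^ k)⁻¹)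
    simpa [hqk.ne', mul_comm] using h3
  refine h1.continuousOn_mul ((continuousOn_one_sub_mul_rpow hc s).mono ?_)
  rw [uIcc_of_le hx]
  obtain ⟨i, rfl⟩ := Nat.exists_eq_add_of_le' (hk.trans hkj)
  exact fun y hy => hy.2.trans_lt (breakpoint_succ_lt_one_div hq0 hq1 hc i)

/-- Only h_{q,0} can be singular, at 1/c, with exponent a - 1 > -1. For j ≥ 1 the recurrence gives a
function continuous up to its breakpoint. -/
theorem intervalIntegrable_basisFn (hq0 : 0 < q) (hq1 : q < 1) (hc : 0 < driftQ q mu)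
    (ha : 0 < lam * r / driftQ q mu) (j : ℕ) :
    ∀ x ≤ breakpoint q mu j,
      IntervalIntegrable (basisFn q mu lam r p j) volume x (breakpoint q mu j) := by
  induction j using Nat.strong_induction_on with
  | _ j ih =>
    intro x hx
    rcases j with - | j
    · unfold basisFn
      exact intervalIntegrable_one_sub_mul_rpow hc (by linarith) _ _
    · have hcont : ContinuousOn (basisFn q mu lam r p (j + 1)) (Iic (breakpoint q mu (j + 1))) := by
        unfold basisFn
        refine ContinuousOn.mul ((continuousOn_one_sub_mul_rpow hc _).mono fun y hy =>
          lt_of_le_of_lt hy (breakpoint_succ_lt_one_div hq0 hq1 hc j)) ?_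
        refine continuousOn_const.sub (continuousOn_const.mul
          (continuousOn_finsetSum _ fun k hk => continuousOn_const.mul
            (continuousOn_integral_left fun y hy => ?_)))
        have hk : k < j + 1 := Finset.mem_range.1 hk
        have hjk : j + 1 - (k + 1) = j - k := by omega
        refine intervalIntegrable_recurrence_aux hq0 hq1 hc (by omega) (by omega) _ ?_ hy
        rw [hjk]
        exact ih (j - k) (by omega)
      refine (hcont.mono fun y hy => ?_).intervalIntegrable
      rw [uIcc_of_le hx] at hy
      exact hy.2

theorem intervalIntegrable_recurrence (hq0 : 0 < q) (hq1 : q < 1) (hc : 0 < driftQ q mu)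
    (ha : 0 < lam * r / driftQ q mu) {j k : ℕ} (hk : 1 ≤ k) (hkj : k ≤ j) {x : ℝ}
    (hx : x ≤ breakpoint q mu j) (s : ℝ) :
    IntervalIntegrable (fun y => (1 - driftQ q mu * y) ^ s *
      basisFn q mu lam r p (j - k) ((q ^ k)⁻¹ * y)) volume x (breakpoint q mu j) :=
  intervalIntegrable_recurrence_aux hq0 hq1 hc hk hkj s
    (intervalIntegrable_basisFn hq0 hq1 hc ha (j - k)) hx

end BasisIntegrability

/-! ### Solving the density equation interval by interval -/

section Identification

open Set Filter Topology

variable {q mu lam r : ℝ} {p : ℕ → ℝ}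

/-- Variation of constants on `[q ^ (j + 1) / c, q ^ j / c]`. -/
theorem density_variation_of_constants {G φ : ℝ → ℝ} (hq0 : 0 < q) (hq1 : q < 1)
    (hc : 0 < driftQ q mu) (hG : Continuous G) (hφ : Integrable φ)
    (hder : ∀ x ∈ Ioo 0 (1 / driftQ q mu), HasDerivAt G (-φ x) x)
    (heq : ∀ j : ℕ, ∀ x ∈ Ico (breakpoint q mu (j + 1)) (1 / driftQ q mu),
      φ x * (1 - driftQ q mu * x) =
        lam * (r * G x - ∑ k ∈ Finset.range j, p (k + 1) * G ((q ^ (k + 1))⁻¹ * x)))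
    (j : ℕ) {x y : ℝ} (hx : breakpoint q mu (j + 1) ≤ x) (hxy : x ≤ y)
    (hy : y ≤ breakpoint q mu j) (hy1 : y < 1 / driftQ q mu) :
    ∫ s in x..y, lam * ∑ k ∈ Finset.range j, (q ^ (k + 1))⁻¹ * p (k + 1) *
        ((1 - driftQ q mu * s) ^ (-(lam * r / driftQ q mu)) * φ ((q ^ (k + 1))⁻¹ * s)) =
      φ y * (1 - driftQ q mu * y) ^ (1 - lam * r / driftQ q mu) -
        φ x * (1 - driftQ q mu * x) ^ (1 - lam * r / driftQ q mu) := by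
  set c := driftQ q mu with hcdef
  set a := lam * r / c with ha
  have hx0 : 0 < x := (breakpoint_pos hq0 hc _).trans_le hx
  -- This is (1 - c s) φ(s) written through `G`, hence differentiable although `φ` is not assumed to
  -- be.
  set W : ℝ → ℝ := fun s =>
    lam * (r * G s - ∑ k ∈ Finset.range j, p (k + 1) * G ((q ^ (k + 1))⁻¹ * s)) with hW
  have hend : ∀ s ∈ Icc x y, φ s * (1 - c * s) ^ (1 - a) = W s * (1 - c * s) ^ (-a) := by
    intro s hs
    have hs1 : s < 1 / c := hs.2.trans_lt hy1
    rw [hW]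
    simp only
    rw [← heq j s ⟨hx.trans hs.1, hs1⟩, mul_assoc, sub_eq_add_neg 1 a,
      Real.rpow_add (one_sub_mul_pos hc hs1), Real.rpow_one]
  have hWc : Continuous W := by fun_prop
  have hmaps : ∀ s ∈ Ioo x y, ∀ k ∈ Finset.range j, (q ^ (k + 1))⁻¹ * s ∈ Ioo 0 (1 / c) := by
    intro s hs k hk
    have hk : k + 1 ≤ j := Finset.mem_range.1 hk
    have hqk := pow_pos hq0 (k + 1)
    have hs0 : 0 < s := hx0.trans hs.1
    refine ⟨by positivity, ?_⟩
    calc (q ^ (k + 1))⁻¹ * s < (q ^ (k + 1))⁻¹ * breakpoint q mu j := by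
          gcongr
          exact hs.2.trans_le hy
      _ = breakpoint q mu (j - (k + 1)) := inv_pow_mul_breakpoint hq0 hk
      _ ≤ breakpoint q mu 0 := breakpoint_antitone hq0 hq1 hc (Nat.zero_le _)
      _ = 1 / c := breakpoint_zero
  have hrpow : ContinuousOn (fun s => (1 - c * s) ^ (-a)) (Icc x y) :=
    (continuousOn_one_sub_mul_rpow hc _).mono fun s hs => hs.2.trans_lt hy1
  rw [hend x ⟨le_rfl, hxy⟩, hend y ⟨hxy, le_rfl⟩]
  refine intervalIntegral.integral_eq_sub_of_hasDeriv_right_of_le hxy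
    (f := fun s => W s * (1 - c * s) ^ (-a)) (hWc.continuousOn.mul hrpow) ?_ ?_
  · intro s hs
    refine HasDerivAt.hasDerivWithinAt ?_
    have hs1 : s < 1 / c := hs.2.trans hy1
    have hpos := one_sub_mul_pos hc hs1
    have hs0 : s ∈ Ioo 0 (1 / c) := ⟨hx0.trans hs.1, hs1⟩
    have hWd : HasDerivAt W (lam * (r * -φ s - ∑ k ∈ Finset.range j, p (k + 1) *
        (-φ ((q ^ (k + 1))⁻¹ * s) * (q ^ (k + 1))⁻¹))) s := by
      refine (((hder s hs0).const_mul r).sub (HasDerivAt.fun_sum fun k hk => ?_)).const_mul lam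
      refine HasDerivAt.const_mul (p (k + 1)) ?_
      have h2 : HasDerivAt (fun s => (q ^ (k + 1))⁻¹ * s) (q ^ (k + 1))⁻¹ s := by
        simpa using (hasDerivAt_id s).const_mul (q ^ (k + 1))⁻¹
      exact (hder _ (hmaps s hs k hk)).comp s h2
    have hPd : HasDerivAt (fun s => (1 - c * s) ^ (-a)) (a * c * (1 - c * s) ^ (-a - 1)) s := by
      have h1 : HasDerivAt (fun s => 1 - c * s) (-c) s := by
        simpa using ((hasDerivAt_id s).const_mul c).const_sub 1
      convert! h1.rpow_const (p := -a) (Or.inl hpos.ne') using 1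
      ring
    refine (hWd.mul hPd).congr_deriv ?_
    have hWs : W s = φ s * (1 - c * s) :=
      (heq j s ⟨hx.trans hs.1.le, hs1⟩).symm
    have hac : a * c = lam * r := div_mul_cancel₀ _ hc.ne'
    have hsplit : (1 - c * s) * (1 - c * s) ^ (-a - 1) = (1 - c * s) ^ (-a) := by
      rw [mul_comm, ← Real.rpow_add_one hpos.ne']
      congr 1; ring
    rw [hWs, hac]
    -- The derivative of the integrating factor produces this term, which cancels the -λ r φ(s)
    -- coming from r G'. The exponent a = λ r / c is chosen for this.
    have e1 : φ s * (1 - c * s) * (lam * r * (1 - c * s) ^ (-a - 1)) =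
        φ s * lam * r * (1 - c * s) ^ (-a) := by
      rw [← hsplit]; ring
    rw [e1]
    have e2 : ∑ k ∈ Finset.range j, (q ^ (k + 1))⁻¹ * p (k + 1) *
        ((1 - c * s) ^ (-a) * φ ((q ^ (k + 1))⁻¹ * s)) =
        -((1 - c * s) ^ (-a) * ∑ k ∈ Finset.range j, p (k + 1) *
        (-φ ((q ^ (k + 1))⁻¹ * s) * (q ^ (k + 1))⁻¹)) := by
      rw [Finset.mul_sum, ← Finset.sum_neg_distrib]
      exact Finset.sum_congr rfl fun k _ => by ring
    rw [e2]
    ring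
  · have hs := IntervalIntegrable.sum (μ := volume) (a := x) (b := y) (Finset.range j)
      (f := fun k s => (q ^ (k + 1))⁻¹ * p (k + 1) *
        ((1 - c * s) ^ (-a) * φ ((q ^ (k + 1))⁻¹ * s))) fun k _ =>
      IntervalIntegrable.const_mul (IntervalIntegrable.continuousOn_mul
        (hφ.comp_mul_left' (inv_ne_zero (pow_pos hq0 (k + 1)).ne')).intervalIntegrable
        (by rwa [uIcc_of_le hxy])) _
    rw [Finset.sum_fn] at hs
    exact hs.const_mul lam

/-- Solutions of the equation for the density are multiples of the basis functions. -/
theorem exists_eq_const_mul_basisFn {G φ : ℝ → ℝ} (hq0 : 0 < q) (hq1 : q < 1)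
    (hc : 0 < driftQ q mu) (ha : 0 < lam * r / driftQ q mu) (hG : Continuous G)
    (hφ : Integrable φ) (hφ0 : ∀ x, 0 ≤ φ x)
    (hder : ∀ x ∈ Ioo 0 (1 / driftQ q mu), HasDerivAt G (-φ x) x)
    (heq : ∀ j : ℕ, ∀ x ∈ Ico (breakpoint q mu (j + 1)) (1 / driftQ q mu),
      φ x * (1 - driftQ q mu * x) =
        lam * (r * G x - ∑ k ∈ Finset.range j, p (k + 1) * G ((q ^ (k + 1))⁻¹ * x))) :
    ∃ K, 0 ≤ K ∧ ∀ j : ℕ, ∀ x ∈ Icc (breakpoint q mu (j + 1)) (breakpoint q mu j),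
      x < 1 / driftQ q mu → φ x = K * basisFn q mu lam r p j x := by
  set c := driftQ q mu with hcdef
  set a := lam * r / c with hadef
  have hvar := density_variation_of_constants hq0 hq1 hc hG hφ hder heq
  simp only [← hcdef, ← hadef] at hvar
  have hb1 := breakpoint_succ_lt_one_div (mu := mu) hq0 hq1 hc
  -- For j = 0 the sum is empty, so φ(x) (1 - c x)^(1 - a) is constant on [q/c, 1/c); the witness is
  -- its value at q/c.
  refine ⟨φ (breakpoint q mu 1) * (1 - c * breakpoint q mu 1) ^ (1 - a),
    mul_nonneg (hφ0 _) (Real.rpow_nonneg (one_sub_mul_pos hc (hb1 0)).le _), ?_⟩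
  set K := φ (breakpoint q mu 1) * (1 - c * breakpoint q mu 1) ^ (1 - a) with hK
  have hsplit : ∀ x < 1 / c, φ x =
      (1 - c * x) ^ (a - 1) * (φ x * (1 - c * x) ^ (1 - a)) := by
    intro x hx
    rw [mul_left_comm, ← Real.rpow_add (one_sub_mul_pos hc hx)]
    simp
  intro j
  induction j using Nat.strong_induction_on with
  | _ j ih =>
    intro x hx hx1
    rcases j with - | j
    · have h1 := hvar 0 le_rfl hx.1 hx.2 hx1
      simp only [Finset.range_zero, Finset.sum_empty, mul_zero,
        intervalIntegral.integral_zero, zero_add] at h1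
      rw [hsplit x hx1, sub_eq_zero.1 h1.symm, mul_comm, basisFn]
    · have h1 := hvar (j + 1) hx.1 hx.2 le_rfl (hb1 j)
      -- The closed intervals share endpoints, so the preceding case supplies the initial value at
      -- the common breakpoint.
      have h2 := ih j (Nat.lt_succ_self j) (breakpoint q mu (j + 1))
        ⟨le_rfl, (breakpoint_succ_lt hq0 hq1 hc j).le⟩ (hb1 j)
      have h3 : 1 - c * breakpoint q mu (j + 1) = 1 - q ^ (j + 1) := by
        rw [breakpoint, mul_div_cancel₀ _ hc.ne']
      have h4 : ∫ s in x..breakpoint q mu (j + 1),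
          lam * ∑ k ∈ Finset.range (j + 1), (q ^ (k + 1))⁻¹ * p (k + 1) *
            ((1 - c * s) ^ (-a) * φ ((q ^ (k + 1))⁻¹ * s)) =
          ∫ s in x..breakpoint q mu (j + 1),
          K * lam * ∑ k ∈ Finset.range (j + 1), (q ^ (k + 1))⁻¹ * p (k + 1) *
            ((1 - c * s) ^ (-a) * basisFn q mu lam r p (j - k) ((q ^ (k + 1))⁻¹ * s)) := by
        -- The endpoint is dropped because for k = j its rescaling is 1/c, where φ = K h_{q,0} is
        -- not available.
        rw [intervalIntegral.integral_of_le hx.2, intervalIntegral.integral_of_le hx.2,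
          integral_Ioc_eq_integral_Ioo, integral_Ioc_eq_integral_Ioo]
        refine setIntegral_congr_fun measurableSet_Ioo fun s hs => ?_
        rw [mul_assoc, mul_left_comm, Finset.mul_sum (a := K)]
        congr 1
        refine Finset.sum_congr rfl fun k hk => ?_
        have hk : k < j + 1 := Finset.mem_range.1 hk
        have hqk := pow_pos hq0 (k + 1)
        have e1 : (q ^ (k + 1))⁻¹ * breakpoint q mu (j + 1) = breakpoint q mu (j - k) := by
          rw [inv_pow_mul_breakpoint hq0 (by omega)]
          congr 1; omega
        have e2 : (q ^ (k + 1))⁻¹ * breakpoint q mu (j + 1 + 1) = breakpoint q mu (j - k + 1) := by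
          rw [inv_pow_mul_breakpoint hq0 (by omega)]
          congr 1; omega
        have e3 : (q ^ (k + 1))⁻¹ * s < breakpoint q mu (j - k) := by
          rw [← e1]
          gcongr
          exact hs.2
        have e4 : breakpoint q mu (j - k + 1) ≤ (q ^ (k + 1))⁻¹ * s := by
          rw [← e2]
          gcongr
          exact hx.1.trans hs.1.le
        rw [ih (j - k) (by omega) _ ⟨e4, e3.le⟩ (e3.trans_le
          ((breakpoint_antitone hq0 hq1 hc (Nat.zero_le _)).trans_eq breakpoint_zero))]
        ring
      have h5 : ∫ s in x..breakpoint q mu (j + 1),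
          K * lam * ∑ k ∈ Finset.range (j + 1), (q ^ (k + 1))⁻¹ * p (k + 1) *
            ((1 - c * s) ^ (-a) * basisFn q mu lam r p (j - k) ((q ^ (k + 1))⁻¹ * s)) =
          K * lam * ∑ k ∈ Finset.range (j + 1), (q ^ (k + 1))⁻¹ * p (k + 1) *
            ∫ s in x..breakpoint q mu (j + 1),
              (1 - c * s) ^ (-a) * basisFn q mu lam r p (j - k) ((q ^ (k + 1))⁻¹ * s) := by
        rw [intervalIntegral.integral_const_mul, intervalIntegral.integral_finsetSum]
        · simp_rw [intervalIntegral.integral_const_mul]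
        · intro k hk
          have hk : k < j + 1 := Finset.mem_range.1 hk
          have := intervalIntegrable_recurrence (p := p) hq0 hq1 hc ha (j := j + 1) (k := k + 1)
            (by omega) (by omega) hx.2 (-a)
          rw [show j + 1 - (k + 1) = j - k by omega] at this
          exact this.const_mul _
      rw [h4, h5, h2, h3] at h1
      rw [hsplit x hx1, eq_sub_of_add_eq' (eq_sub_iff_add_eq.1 h1), basisFn]
      ring

end Identification

/-! ### The normalising constant -/

section Normalisation

open Set Filter Topology

variable {q mu lam r : ℝ} {p : ℕ → ℝ}

theorem exists_mem_Ioc_breakpoint (hq0 : 0 < q) (hq1 : q < 1) (hc : 0 < driftQ q mu) {x : ℝ}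
    (hx : x ∈ Ioc 0 (1 / driftQ q mu)) :
    ∃ j, x ∈ Ioc (breakpoint q mu (j + 1)) (breakpoint q mu j) := by
  obtain ⟨j, hj1, hj2⟩ := exists_nat_pow_near_of_lt_one (mul_pos hx.1 hc)
    ((le_div_iff₀ hc).1 hx.2) hq0 hq1
  exact ⟨j, (div_lt_iff₀ hc).2 hj1, (le_div_iff₀ hc).2 hj2⟩

theorem densityFn_eq_of_mem (hq0 : 0 < q) (hq1 : q < 1) (hc : 0 < driftQ q mu) {x : ℝ} {j : ℕ}
    (hx : x ∈ Ioc (breakpoint q mu (j + 1)) (breakpoint q mu j)) :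
    densityFn q mu lam r p x = 1 / normConst q mu lam r p * basisFn q mu lam r p j x := by
  rw [densityFn, tsum_eq_single j, if_pos (And.intro hx.1 hx.2)]
  intro i hi
  refine if_neg fun hxi => ?_
  have := (breakpoint_antitone hq0 hq1 hc).pairwise_disjoint_on_Ioc_succ hi
  exact Set.disjoint_left.1 this (show x ∈ Ioc _ _ from hxi) hx

theorem densityFn_eq_zero (hq0 : 0 < q) (hq1 : q < 1) (hc : 0 < driftQ q mu) {x : ℝ}
    (hx : x ∉ Ioc 0 (1 / driftQ q mu)) : densityFn q mu lam r p x = 0 := by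
  rw [densityFn]
  have : ∀ j, ¬ (breakpoint q mu (j + 1) < x ∧ x ≤ breakpoint q mu j) := fun j hj =>
    hx ⟨(breakpoint_pos hq0 hc _).trans hj.1, hj.2.trans
      ((breakpoint_antitone hq0 hq1 hc (Nat.zero_le j)).trans_eq breakpoint_zero)⟩
  simp [this]

/-- A probability density that is proportional to the basis functions determines the normalising
constant. -/
theorem densityFn_eq_of_eq_const_mul {φ : ℝ → ℝ} (hq0 : 0 < q) (hq1 : q < 1)
    (hc : 0 < driftQ q mu) (hφ : Integrable φ) (h1 : ∫ x, φ x = 1)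
    (hsupp : ∀ x ∉ Ioo 0 (1 / driftQ q mu), φ x = 0) {K : ℝ} (hK0 : 0 ≤ K)
    (hK : ∀ j : ℕ, ∀ x ∈ Icc (breakpoint q mu (j + 1)) (breakpoint q mu j),
      x < 1 / driftQ q mu → φ x = K * basisFn q mu lam r p j x) :
    Summable (basisMass q mu lam r p) ∧ 0 < normConst q mu lam r p ∧
      ∀ x, densityFn q mu lam r p x =
        if x = 1 / driftQ q mu then K * basisFn q mu lam r p 0 x else φ x := by
  -- If K were 0, then `φ` would vanish identically and could not have integral 1.
  have hK' : 0 < K := by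
    refine lt_of_le_of_ne hK0 fun hK1 => ?_
    have : ∀ x, φ x = 0 := by
      intro x
      by_cases hx : x ∈ Ioo 0 (1 / driftQ q mu)
      · obtain ⟨j, hj⟩ := exists_mem_Ioc_breakpoint hq0 hq1 hc (Ioo_subset_Ioc_self hx)
        rw [hK j x (Ioc_subset_Icc_self hj) hx.2, ← hK1, zero_mul]
      · exact hsupp x hx
    simp [this] at h1
  have hmass : ∀ j, basisMass q mu lam r p j =
      K⁻¹ * ∫ x in Ioc (breakpoint q mu (j + 1)) (breakpoint q mu j), φ x := by
    intro j
    rw [basisMass, intervalIntegral.integral_of_le (breakpoint_succ_lt hq0 hq1 hc j).le,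
      integral_Ioc_eq_integral_Ioo, integral_Ioc_eq_integral_Ioo, ← integral_const_mul]
    refine setIntegral_congr_fun measurableSet_Ioo fun x hx => ?_
    rw [hK j x (Ioo_subset_Icc_self hx) (hx.2.trans_le
      ((breakpoint_antitone hq0 hq1 hc (Nat.zero_le j)).trans_eq breakpoint_zero)),
      inv_mul_cancel_left₀ hK'.ne']
  have hunion : (⋃ j, Ioc (breakpoint q mu (j + 1)) (breakpoint q mu j)) =
      Ioc 0 (1 / driftQ q mu) := by
    ext x
    refine ⟨fun hx => ?_, fun hx => mem_iUnion.2 (exists_mem_Ioc_breakpoint hq0 hq1 hc hx)⟩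
    obtain ⟨j, hj⟩ := mem_iUnion.1 hx
    exact ⟨(breakpoint_pos hq0 hc _).trans hj.1, hj.2.trans
      ((breakpoint_antitone hq0 hq1 hc (Nat.zero_le j)).trans_eq breakpoint_zero)⟩
  -- Countable additivity over the half-open intervals that partition (0, 1/c] yields convergence of
  -- the series and its value at once.
  have hsum : HasSum (basisMass q mu lam r p) K⁻¹ := by
    have h2 := (hasSum_integral_iUnion (f := φ) (μ := volume) (fun _ => measurableSet_Ioc)
      (breakpoint_antitone hq0 hq1 hc).pairwise_disjoint_on_Ioc_succ hφ.integrableOn).mul_left K⁻¹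
    simp only [Order.succ_eq_add_one] at h2
    rw [hunion, setIntegral_eq_integral_of_forall_compl_eq_zero fun x hx =>
      hsupp x fun hx' => hx (Ioo_subset_Ioc_self hx'), h1, mul_one] at h2
    rwa [funext hmass]
  have hnorm : normConst q mu lam r p = K⁻¹ := hsum.tsum_eq
  refine ⟨hsum.summable, by rw [hnorm]; positivity, fun x => ?_⟩
  -- The point 1/c is exceptional: `φ` is 0 there by hypothesis, whereas the formula for the density
  -- uses h_{q,0}(1/c).
  split_ifs with hx
  · rw [densityFn_eq_of_mem (j := 0) hq0 hq1 hc, hnorm, one_div, inv_inv]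
    exact ⟨hx ▸ breakpoint_succ_lt_one_div hq0 hq1 hc 0, by rw [hx, breakpoint_zero]⟩
  · by_cases hx' : x ∈ Ioc 0 (1 / driftQ q mu)
    · obtain ⟨j, hj⟩ := exists_mem_Ioc_breakpoint hq0 hq1 hc hx'
      rw [densityFn_eq_of_mem hq0 hq1 hc hj, hnorm, one_div, inv_inv,
        hK j x (Ioc_subset_Icc_self hj) (lt_of_le_of_ne hx'.2 hx)]
    · rw [densityFn_eq_zero hq0 hq1 hc hx', hsupp x fun h => hx' (Ioo_subset_Ioc_self h)]

theorem HasExpMoments.eq_withDensity_densityFn {κ : Measure ℕ} {ν : Measure ℝ} [IsProbabilityMeasure κ]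
    [IsProbabilityMeasure ν] (h : HasExpMoments q (driftQ q mu) lam κ ν) (hc : 0 < driftQ q mu)
    (hlam : 0 < lam) (hq0 : 0 < q) (hq1 : q < 1) (hp : ∀ k, p k = κ.real {k})
    (hr : r = κ.real {k | 1 ≤ k}) (hr0 : 0 < r) :
    Summable (basisMass q mu lam r p) ∧ 0 < normConst q mu lam r p ∧
      Measurable (densityFn q mu lam r p) ∧ (∀ x, 0 ≤ densityFn q mu lam r p x) ∧
      ν = volume.withDensity fun x => ENNReal.ofReal (densityFn q mu lam r p x) := by
  set c := driftQ q mu with hcdef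
  set φ := expDensity q c lam κ ν with hφdef
  have hφm : Measurable φ := measurable_expDensity
  have hφ0 := h.expDensity_nonneg hc hlam.le hq0 hq1
  have hν := h.eq_withDensity hc hlam hq0 hq1 (hr ▸ hr0)
  have hφ := integrable_of_eq_withDensity hφm hφ0 hν
  have hG := continuous_real_Ioi hφm hφ0 hν
  have hφ1 : ∫ x, φ x = 1 := by
    rw [← setIntegral_univ, ← real_eq_setIntegral_of_eq_withDensity hφm hφ0 hν MeasurableSet.univ]
    simp
  obtain ⟨K, hK0, hK⟩ := exists_eq_const_mul_basisFn (mu := mu) (lam := lam) (r := r) (p := p)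
    (G := fun x => ν.real (Ioi x)) hq0 hq1 hc (div_pos (mul_pos hlam hr0) hc) hG hφ hφ0
    (fun x hx => hasDerivAt_real_Ioi hφm hφ0 hν (continuousAt_expDensity hc hq0 hG hx))
    (fun j x hx => by
      simp only [hp, hr]
      exact h.expDensity_mul hc hq0 hq1 j hx)
  obtain ⟨hsum, hnorm, hdens⟩ := densityFn_eq_of_eq_const_mul hq0 hq1 hc hφ hφ1
    (fun x hx => indicator_of_notMem hx _) hK0 hK
  have hb : ∀ x, x = 1 / c → 0 ≤ K * basisFn q mu lam r p 0 x := by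
    intro x hx
    refine mul_nonneg hK0 ?_
    rw [basisFn]
    -- At x = 1/c the base is 0, and the real power is then 0, or 1 for exponent 0.
    exact Real.rpow_nonneg (by rw [hx, ← hcdef, mul_one_div_cancel hc.ne', sub_self]) _
  refine ⟨hsum, hnorm, ?_, fun x => ?_, ?_⟩
  · rw [funext hdens]
    refine Measurable.ite (measurableSet_singleton _) ?_ hφm
    unfold basisFn
    fun_prop
  · rw [hdens]
    split_ifs with hx
    exacts [hb x hx, hφ0 x]
  · refine hν.trans (withDensity_congr_ae ?_)
    filter_upwards [Measure.ae_ne volume (1 / c)] with x hx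
    rw [hdens, if_neg hx]

end Normalisation

/-! ### The law of the exponential functional -/

theorem mainTheorem2 {Ω : Type*} [MeasurableSpace Ω] (P : Measure Ω) [IsProbabilityMeasure P]
    (lam : ℝ≥0) (hlam : 0 < lam) (N : ℝ≥0 → Ω → ℕ) (Z : ℕ → Ω → ℕ)
    (hNZ : IsCompoundPoissonData P lam N Z)
    (p : ℕ → ℝ) (hp : ∀ k, p k = P.real {ω | Z 0 ω = k})
    (r : ℝ) (hr : r = P.real {ω | 1 ≤ Z 0 ω}) (hr0 : 0 < r)
    (mu : ℝ) (hmu : 0 < mu) (q : ℝ) (hq0 : 0 < q) (hq1 : q < 1) :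
    -- `I_q` is a.s. a convergent integral
    (∀ᵐ ω ∂P, IntegrableOn (expIntegrand q mu (compoundPoisson N Z) ω) (Set.Ioi 0)) ∧
    -- all integrals in the recurrence converge
    (∀ j k : ℕ, 1 ≤ k → k ≤ j → ∀ x ≤ breakpoint q mu j,
      IntervalIntegrable
        (fun y => (1 - driftQ q mu * y) ^ (-(lam * r / driftQ q mu)) *
          basisFn q mu lam r p (j - k) ((q ^ k)⁻¹ * y))
        volume x (breakpoint q mu j)) ∧
    -- the normalising constant is well defined, finite and positive
    (∀ j : ℕ, IntervalIntegrable (basisFn q mu lam r p j) volume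
      (breakpoint q mu (j + 1)) (breakpoint q mu j)) ∧
    Summable (basisMass q mu lam r p) ∧
    0 < normConst q mu lam r p ∧
    -- `φ_q` is a probability density of `I_q`
    Measurable (densityFn q mu lam r p) ∧
    (∀ x, 0 ≤ densityFn q mu lam r p x) ∧
    HasLaw (expFunctional q mu (compoundPoisson N Z))
      (volume.withDensity fun x => ENNReal.ofReal (densityFn q mu lam r p x)) P := by
  have hc := driftQ_pos hq0 hq1 hmu
  have ha : 0 < (lam : ℝ) * r / driftQ q mu := div_pos (mul_pos hlam hr0) hc
  -- The regular version agrees with `N` at all times simultaneously, almost surely, so the two path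
  -- integrals agree almost surely.
  obtain ⟨N', hNZ', hN', hae⟩ := hNZ.exists_hasRegularPaths
  have hm := hNZ'.poisson.measurable
  have hZ := hNZ.measurable
  have hint : ∀ᵐ ω ∂P, expIntegrand q mu (compoundPoisson N Z) ω =
      expIntegrand q mu (compoundPoisson N' Z) ω := by
    filter_upwards [hae] with ω hω
    ext t
    simp only [expIntegrand, compoundPoisson, hω]
  have hfun : expFunctional q mu (compoundPoisson N Z) =ᵐ[P]
      expFunctional q mu (compoundPoisson N' Z) := by
    filter_upwards [hint] with ω hω
    simp only [expFunctional, hω]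
  have hIm : Measurable (expFunctional q mu (compoundPoisson N' Z)) :=
    measurable_expFunctional hN' hm hZ
  set κ := P.map (Z 0) with hκ
  set ν := P.map (expFunctional q mu (compoundPoisson N' Z)) with hν
  have : IsProbabilityMeasure κ := Measure.isProbabilityMeasure_map (hZ 0).aemeasurable
  have : IsProbabilityMeasure ν := Measure.isProbabilityMeasure_map hIm.aemeasurable
  have hmom : HasExpMoments q (driftQ q mu) lam κ ν := by
    refine ⟨?_, fun n => ?_⟩
    · exact (ae_map_iff (p := fun x => x ∈ Set.Icc 0 (1 / driftQ q mu)) hIm.aemeasurable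
        measurableSet_Icc).2 (.of_forall (expFunctional_mem_Icc hN' hm hZ hq0 hq1 hmu))
    · have h := laplaceExp_mul_moment hNZ' hN' hq0 hq1 hmu n
      rw [hν, integral_map hIm.aemeasurable (by fun_prop), integral_map hIm.aemeasurable
        (by fun_prop), ← h, hκ, integral_map (hZ 0).aemeasurable .of_discrete, laplaceExp, jumpGen]
      push_cast
      rfl
  have hκm : ∀ s : Set ℕ, κ.real s = P.real (Z 0 ⁻¹' s) := fun s =>
    map_measureReal_apply (hZ 0) .of_discrete
  obtain ⟨hsum, hnorm, hdm, hd0, hlaw⟩ := hmom.eq_withDensity_densityFn (p := p) (r := r) hc hlam hq0 hq1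
    (fun k => (hp k).trans (hκm {k}).symm) (hr.trans (hκm {k | 1 ≤ k}).symm) hr0
  refine ⟨?_, fun j k hk hkj x hx => intervalIntegrable_recurrence hq0 hq1 hc ha hk hkj hx _,
    fun j => intervalIntegrable_basisFn hq0 hq1 hc ha j _ (breakpoint_succ_lt hq0 hq1 hc j).le,
    hsum, hnorm, hdm, hd0, ?_⟩
  · filter_upwards [hint] with ω hω
    rw [hω]
    exact integrableOn_expIntegrand hN' hm hZ hq0 hq1 hmu ω 0
  · exact ⟨hIm.aemeasurable.congr hfun.symm, by rw [Measure.map_congr hfun, ← hν, hlaw]⟩
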